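/- Let $(Y,g)$ be a complete smooth Riemannian manifold whose sectional curvatures are bounded, $|K|\le\Lambda$ for some constant $\Lambda$. Let $f:Y\to\mathbb{R}$ be a smooth function and $\delta>0$ a constant such that 1. $\|\operatorname{grad} f\|\equiv 1$; 2. $f$ has pinched convex levels: there are constants $0<c_1\le c_2$ such that $c_1\le (f\circ c)''(0)\le c_2$ for every unit speed geodesic $c:(-\eta,\eta)\to Y$ with $\dot c(0)\perp \operatorname{grad} f(c(0))$; 3. $K(\sigma_p)<-\delta$ for every $p\in Y$ and every tangent plane $\sigma_p\subset T_pY$ containing $\operatorname{grad} f(p)$. Then $(Y,g)$ is Lipschitz equivalent to a Riemannian manifold of pinched negative sectional curvature. More precisely, for $\lambda>0$ let $h^\lambda$ be the metric on $Y$ for which $\mathbb{R}\operatorname{grad} f$ and its $g$-orthogonal complement are orthogonal, which agrees with $g$ on this complement and with $\lambda^{-2}g$ on $\mathbb{R}\operatorname{grad} f$, that is, $h^\lambda=g-(1-\lambda^{-2})\,df\otimes df$. Then there is $\lambda_0>0$ such that for every $\lambda\ge\lambda_0$: $h^\lambda$ is a smooth Riemannian metric; there are constants $0<a\le b$ (which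 may depend on $\lambda$) such that all sectional curvatures of $h^\lambda$ lie in $[-b^2,-a^2]$; and the identity map is bi-Lipschitz between the Riemannian distances of $g$ and $h^\lambda$. -/

import Mathlib

open scoped Manifold ContDiff Topology ENNReal NNReal Bundle

noncomputable section

/-! ### Riemannian geometry in coordinates

`G : E → E →L[ℝ] E →L[ℝ] ℝ` is a metric tensor on (an open subset of) a finite-dimensional vector
space `E`: `G x u v` is the inner product at `x` of the constant vectors `u` and `v`. -/

section Coordinates

variable {E : Type*} [NormedAddCommGroup E] [NormedSpace ℝ E]

/-- The Christoffel form of the first kind, as a covector: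
`w ↦ (D_u G (v, w) + D_v G (u, w) - D_w G (u, v)) / 2`, which is `⟨∇_u v, w⟩` for the Levi-Civita
connection `∇` of `G` and constant vector fields `u`, `v`, `w`. -/
def christoffelFirst (G : E → E →L[ℝ] E →L[ℝ] ℝ) (x u v : E) : E →L[ℝ] ℝ :=
  (1 / 2 : ℝ) • (fderiv ℝ G x u v + fderiv ℝ G x v u - ((fderiv ℝ G x).flip u).flip v)

/-- The Christoffel symbols `Γ_x(u, v) = Γ^k_{ij} u^i v^j ∂_k`: the vector `∇_u v` at `x` for
constant vector fields `u`, `v`. The index is raised with the inverse of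
`G x : E →L[ℝ] (E →L[ℝ] ℝ)`. -/
def christoffel (G : E → E →L[ℝ] E →L[ℝ] ℝ) (x u v : E) : E :=
  (G x).inverse (christoffelFirst G x u v)

/-- The curvature tensor `R(u, v) w = ∇_u ∇_v w - ∇_v ∇_u w` for constant vector fields. -/
def riemannTensor (G : E → E →L[ℝ] E →L[ℝ] ℝ) (x u v w : E) : E :=
  fderiv ℝ (fun y => christoffel G y v w) x u - fderiv ℝ (fun y => christoffel G y u w) x v
    + christoffel G x u (christoffel G x v w) - christoffel G x v (christoffel G x u w)

/-- The sectional curvature `⟨R(u, v) v, u⟩ / (|u|² |v|² - ⟨u, v⟩²)` at `x` of the plane spanned by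
`u` and `v`. -/
def coordSectionalCurvature (G : E → E →L[ℝ] E →L[ℝ] ℝ) (x u v : E) : ℝ :=
  G x (riemannTensor G x u v v) u / (G x u u * G x v v - G x u v ^ 2)

end Coordinates

/-! ### Riemannian manifolds -/

section Manifold

/-- A smooth Riemannian metric on the manifold `Y` modelled on `E`. -/
abbrev SmoothMetric (E : Type*) [NormedAddCommGroup E] [NormedSpace ℝ E]
    (Y : Type*) [TopologicalSpace Y] [ChartedSpace E Y] [IsManifold 𝓘(ℝ, E) ∞ Y] :=
  Bundle.ContMDiffRiemannianMetric 𝓘(ℝ, E) ∞ E (fun p : Y => TangentSpace 𝓘(ℝ, E) p)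

variable {E : Type*} [NormedAddCommGroup E] [NormedSpace ℝ E]
  {Y : Type*} [TopologicalSpace Y] [ChartedSpace E Y] [IsManifold 𝓘(ℝ, E) ∞ Y]

/-- The Riemannian distance of `g`: the infimum of the lengths of `C^1` paths (`∞` between
different connected components). -/
def riemDist (g : SmoothMetric E Y) (p q : Y) : ℝ≥0∞ :=
  letI : Bundle.RiemannianBundle (fun p : Y => TangentSpace 𝓘(ℝ, E) p) := ⟨g.toRiemannianMetric⟩
  Manifold.riemannianEDist 𝓘(ℝ, E) p q

/-- The metric `g` is complete: every Cauchy sequence for the Riemannian distance converges. -/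
def IsCompleteMetric (g : SmoothMetric E Y) : Prop :=
  ∀ u : ℕ → Y,
    (∀ ε : ℝ≥0∞, 0 < ε → ∃ N : ℕ, ∀ m ≥ N, ∀ n ≥ N, riemDist g (u m) (u n) < ε) →
      ∃ p : Y, Filter.Tendsto u Filter.atTop (𝓝 p)

/-- The metric tensor of `g` in the chart around `q`, `G_x(u, v) = g(dψ_x u, dψ_x v)` where `ψ` is
the inverse of the chart (every `TangentSpace 𝓘(ℝ, E) p` is a copy of `E`). It is relevant for `x` in the (open) image of the chart. -/
def coordMetric (g : SmoothMetric E Y) (q : Y) (x : E) : E →L[ℝ] E →L[ℝ] ℝ :=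
  let ψ : Y := (extChartAt 𝓘(ℝ, E) q).symm x
  let dψ : E →L[ℝ] E := mfderiv 𝓘(ℝ, E) 𝓘(ℝ, E) (extChartAt 𝓘(ℝ, E) q).symm x
  let gψ : E →L[ℝ] E →L[ℝ] ℝ := g.inner ψ
  gψ.bilinearComp dψ dψ

/-- The sectional curvature at `p` of the plane spanned by the tangent vectors `u`, `v`, computed in
the chart around `p`. -/
def sectionalCurvature (g : SmoothMetric E Y) (p : Y) (u v : TangentSpace 𝓘(ℝ, E) p) : ℝ :=
  coordSectionalCurvature (coordMetric g p) (extChartAt 𝓘(ℝ, E) p p)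
    (mfderiv 𝓘(ℝ, E) 𝓘(ℝ, E) (extChartAt 𝓘(ℝ, E) p) p u)
    (mfderiv 𝓘(ℝ, E) 𝓘(ℝ, E) (extChartAt 𝓘(ℝ, E) p) p v)

/-- The sectional curvatures of all tangent planes lie in an interval `[-b², -a²]`, `0 < a ≤ b`. -/
def HasPinchedNegativeCurvature (g : SmoothMetric E Y) : Prop :=
  ∃ a b : ℝ, 0 < a ∧ a ≤ b ∧
    ∀ (p : Y) (u v : TangentSpace 𝓘(ℝ, E) p), LinearIndependent ℝ ![u, v] →
      -b ^ 2 ≤ sectionalCurvature g p u v ∧ sectionalCurvature g p u v ≤ -a ^ 2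

/-- The gradient of `f`: the vector representing the differential `df_p` with respect to `g`. -/
def riemGrad (g : SmoothMetric E Y) (f : Y → ℝ) (p : Y) : TangentSpace 𝓘(ℝ, E) p :=
  (g.inner p).inverse (mfderiv 𝓘(ℝ, E) 𝓘(ℝ, ℝ) f p)

/-- The velocity vector of a curve. -/
def velocity (c : ℝ → Y) (t : ℝ) : TangentSpace 𝓘(ℝ, E) (c t) :=
  mfderiv 𝓘(ℝ, ℝ) 𝓘(ℝ, E) c t (1 : ℝ)

/-- `c` is a geodesic of `g` on the open interval `(a, b)`: it is `C^2` and at each time `t` it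
satisfies the geodesic equation `x'' + Γ_x(x', x') = 0` in a chart around `c t`. (The left-hand side
is the covariant acceleration `∇_{c'} c'` in coordinates, so that the chart does not matter.) -/
def IsGeodesicOn (g : SmoothMetric E Y) (c : ℝ → Y) (a b : ℝ) : Prop :=
  ContMDiffOn 𝓘(ℝ, ℝ) 𝓘(ℝ, E) 2 c (Set.Ioo a b) ∧
    ∀ t ∈ Set.Ioo a b, ∃ q : Y, c t ∈ (chartAt E q).source ∧
      let x : ℝ → E := fun s => extChartAt 𝓘(ℝ, E) q (c s)
      deriv (deriv x) t + christoffel (coordMetric g q) (x t) (deriv x t) (deriv x t) = 0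

/-- `c` is a unit speed geodesic of `g` on `(a, b)`. -/
def IsUnitSpeedGeodesicOn (g : SmoothMetric E Y) (c : ℝ → Y) (a b : ℝ) : Prop :=
  IsGeodesicOn g c a b ∧
    ∀ t ∈ Set.Ioo a b, g.inner (c t) (velocity c t) (velocity c t) = 1

/-- `f` has pinched convex levels: `c₁ ≤ (f ∘ c)''(0) ≤ c₂` for some constants `0 < c₁ ≤ c₂` and all
unit speed geodesics `c : (-η, η) → Y` with `c'(0)` orthogonal to `grad f`. -/
def HasPinchedConvexLevels (g : SmoothMetric E Y) (f : Y → ℝ) : Prop :=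
  ∃ c₁ c₂ : ℝ, 0 < c₁ ∧ c₁ ≤ c₂ ∧
    ∀ (η : ℝ) (c : ℝ → Y), 0 < η → IsUnitSpeedGeodesicOn g c (-η) η →
      g.inner (c 0) (velocity c 0) (riemGrad g f (c 0)) = 0 →
        c₁ ≤ deriv (deriv (f ∘ c)) 0 ∧ deriv (deriv (f ∘ c)) 0 ≤ c₂

/-- `h` is the metric `g` stretched by `l` in the direction of the unit vector field `grad f`: the
splitting into `ℝ grad f` and its `g`-orthogonal complement remains orthogonal, `h = g` on the
complement, and `h = g / l²` on `ℝ grad f`. -/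
def IsStretchedMetric (g : SmoothMetric E Y) (f : Y → ℝ) (l : ℝ) (h : SmoothMetric E Y) : Prop :=
  ∀ (p : Y) (s t : ℝ) (u v : TangentSpace 𝓘(ℝ, E) p),
    g.inner p u (riemGrad g f p) = 0 → g.inner p v (riemGrad g f p) = 0 →
      h.inner p (s • riemGrad g f p + u) (t • riemGrad g f p + v) = s * t / l ^ 2 + g.inner p u v

/-- The identity map is a bi-Lipschitz map between the Riemannian distances of `g` and `h`. -/
def LipschitzEquivalent (g h : SmoothMetric E Y) : Prop :=
  ∃ L : ℝ≥0, ∀ p q : Y,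
    riemDist g p q ≤ L * riemDist h p q ∧ riemDist h p q ≤ L * riemDist g p q

end Manifold

end

/-! Since `f` has unit gradient, the Christoffel symbols of `h = g - (1 - l⁻²) df ⊗ df` are
`Γ - (l² - 1) Hess f ⊗ grad f`. The Ricci identity for `Hess f` turns this into a Gauss equation:
`⟨R(u, v) v, u⟩` changes by `-(l² - 1)` times the Gram determinant of `u`, `v` for `Hess f`. A
tangent plane is spanned by some `v ⊥ grad f` and some `s grad f + w` with `w ⊥ grad f, v`. Since
`Hess f` annihilates `grad f` and is pinched positive on its complement, the Gauss term is a large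
negative multiple of `|w|² |v|²`, whereas the `g`-curvature contributes at most `-δ s² |v|²`, a
multiple of `|w|² |v|²`, and a mixed term; the Peter–Paul inequality absorbs the mixed term into
the two others once `l` is large. -/

noncomputable section

set_option maxSynthPendingDepth 3

section InnerForms

variable {E : Type*} [NormedAddCommGroup E] [NormedSpace ℝ E]
  {B H : E →L[ℝ] E →L[ℝ] ℝ} {α : E →L[ℝ] ℝ} {N u v w : E} {l c₁ c₂ : ℝ}

/-- `B` is an inner product on `E`, given as a continuous bilinear form. The norm it defines need
not be equivalent to the norm of `E`. -/
structure IsInnerForm (B : E →L[ℝ] E →L[ℝ] ℝ) : Prop where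
  symm : ∀ u v, B u v = B v u
  pos : ∀ u, u ≠ 0 → 0 < B u u

/-- The form `B` stretched by `l` in the direction of the covector `α`. If `α = B N` for a
`B`-unit vector `N`, then `N` keeps its `B`-orthogonal complement, on which the form remains `B`,
and the length of `N` becomes `1 / l`. -/
def stretchedForm (B : E →L[ℝ] E →L[ℝ] ℝ) (α : E →L[ℝ] ℝ) (l : ℝ) : E →L[ℝ] E →L[ℝ] ℝ :=
  B - (1 - (l ^ 2)⁻¹) • α.smulRight α

theorem stretchedForm_apply (u v : E) :
    stretchedForm B α l u v = B u v - (1 - (l ^ 2)⁻¹) * (α u * α v) := by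
  simp [stretchedForm]

theorem stretchedForm_le (hl : 1 ≤ l) (u : E) : stretchedForm B α l u u ≤ B u u := by
  have : (l ^ 2)⁻¹ ≤ 1 := inv_le_one_of_one_le₀ (one_le_pow₀ hl)
  rw [stretchedForm_apply]
  nlinarith [mul_self_nonneg (α u)]

theorem exists_eq_smul_add (hN : B N N = 1) (u : E) : ∃ w, B N w = 0 ∧ u = B N u • N + w :=
  ⟨u - B N u • N, by simp [hN], by abel⟩

theorem bilin_add_self_le {t : ℝ} (ht : 0 < t) (h : 0 ≤ B (t • u - w) (t • u - w)) :
    B (u + w) (u + w) ≤ (1 + t) * B u u + (1 + t⁻¹) * B w w := by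
  have hcross : t * (B u w + B w u) ≤ t * (t * B u u + t⁻¹ * B w w) := by
    simp only [map_sub, map_smul, sub_apply, smul_apply, smul_eq_mul] at h
    rw [mul_add t (t * _), mul_inv_cancel_left₀ ht.ne']
    linarith
  have := le_of_mul_le_mul_left hcross ht
  simp only [map_add, add_apply]
  linarith

namespace IsInnerForm

theorem apply_self_nonneg (hB : IsInnerForm B) (u : E) : 0 ≤ B u u := by
  rcases eq_or_ne u 0 with rfl | h
  · simp
  · exact (hB.pos u h).le

theorem apply_sq_le (hB : IsInnerForm B) (u v : E) : B u v ^ 2 ≤ B u u * B v v :=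
  B.toBilinForm.apply_sq_le_of_symm hB.apply_self_nonneg ⟨hB.symm⟩ u v

theorem linearIndependent_of_orthogonal (hB : IsInnerForm B) (hu : u ≠ 0) (hv : v ≠ 0)
    (h : B u v = 0) : LinearIndependent ℝ ![u, v] := by
  rw [LinearIndependent.pair_iff]
  intro s t hst
  have hs : B (s • u + t • v) u = 0 := by simp [hst]
  have ht : B (s • u + t • v) v = 0 := by simp [hst]
  simp only [map_add, map_smul, add_apply, smul_apply, smul_eq_mul, hB.symm v u, h] at hs ht
  exact ⟨by simpa [(hB.pos u hu).ne'] using hs, by simpa [(hB.pos v hv).ne'] using ht⟩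

theorem isInvertible [FiniteDimensional ℝ E] (hB : IsInnerForm B) : B.IsInvertible := by
  have hinj : Function.Injective B := by
    refine (injective_iff_map_eq_zero B).2 fun u hu => ?_
    by_contra h
    simpa [hu] using hB.pos u h
  have hdim : Module.finrank ℝ E = Module.finrank ℝ (E →L[ℝ] ℝ) := by
    rw [← (LinearMap.toContinuousLinearMap (𝕜 := ℝ) (E := E) (F' := ℝ)).finrank_eq]
    exact Subspace.dual_finrank_eq.symm
  exact ⟨(LinearEquiv.ofInjectiveOfFinrankEq (B : E →ₗ[ℝ] E →L[ℝ] ℝ) hinj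
    hdim).toContinuousLinearEquiv, rfl⟩

theorem pinched_of_pinched_on_unit (hB : IsInnerForm B) {S : Submodule ℝ E}
    (h : ∀ u ∈ S, B u u = 1 → c₁ ≤ H u u ∧ H u u ≤ c₂) (hu : u ∈ S) :
    c₁ * B u u ≤ H u u ∧ H u u ≤ c₂ * B u u := by
  rcases eq_or_ne u 0 with rfl | hu₀
  · simp
  have hpos := hB.pos u hu₀
  set r := √(B u u)
  have hr : 0 < r := Real.sqrt_pos.2 hpos
  have hr₂ : B u u = r ^ 2 := (Real.sq_sqrt hpos.le).symm
  have hunit := h (r⁻¹ • u) (S.smul_mem _ hu) (by simp [hr₂]; field_simp)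
  have hscale : H (r⁻¹ • u) (r⁻¹ • u) = H u u / r ^ 2 := by simp; field_simp
  rwa [hscale, le_div_iff₀ (by positivity), div_le_iff₀ (by positivity), ← hr₂] at hunit

/-- The lower bound is the Cauchy–Schwarz inequality for `H - c₁ • B`. -/
theorem gram_det_bounds_of_pinched (hB : IsInnerForm B) (hH : ∀ u v, H u v = H v u)
    {S : Submodule ℝ E} (hc₁ : 0 < c₁) (hpinch : ∀ u ∈ S, c₁ * B u u ≤ H u u ∧ H u u ≤ c₂ * B u u)
    (hv : v ∈ S) (hw : w ∈ S) (hvw : B v w = 0) :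
    c₁ ^ 2 * (B v v * B w w) ≤ H v v * H w w - H v w ^ 2 ∧
      H v v * H w w - H v w ^ 2 ≤ c₂ ^ 2 * (B v v * B w w) := by
  obtain ⟨hv₁, hv₂⟩ := hpinch v hv
  obtain ⟨hw₁, hw₂⟩ := hpinch w hw
  have hv₀ : 0 ≤ c₁ * B v v := mul_nonneg hc₁.le (hB.apply_self_nonneg v)
  have hw₀ : 0 ≤ c₁ * B w w := mul_nonneg hc₁.le (hB.apply_self_nonneg w)
  have hquad (t : ℝ) : 0 ≤ (H w w - c₁ * B w w) * (t * t) + 2 * H v w * t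
      + (H v v - c₁ * B v v) := by
    have h := (hpinch (v + t • w) (S.add_mem hv (S.smul_mem t hw))).1
    simp only [map_add, map_smul, add_apply, smul_apply, smul_eq_mul, hH w v, hB.symm w v,
      hvw] at h
    linarith
  have hdiscrim := discrim_le_zero hquad
  rw [discrim] at hdiscrim
  constructor
  · nlinarith [mul_le_mul_of_nonneg_left hw₁ hv₀, mul_le_mul_of_nonneg_left hv₁ hw₀]
  · have hprod : H v v * H w w ≤ c₂ * B v v * (c₂ * B w w) :=
      mul_le_mul hv₂ hw₂ (hw₀.trans hw₁) (hv₀.trans (hv₁.trans hv₂))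
    linarith [sq_nonneg (H v w)]

theorem exists_orthogonal_basis_apply_eq_zero (hB : IsInnerForm B) (α : E →L[ℝ] ℝ)
    (huv : LinearIndependent ℝ ![u, v]) :
    ∃ a b c d : ℝ, a * d ≠ b * c ∧ α (c • u + d • v) = 0 ∧
      B (a • u + b • v) (c • u + d • v) = 0 := by
  obtain ⟨a, b, c, d, hdet, hα⟩ :
      ∃ a b c d : ℝ, a * d ≠ b * c ∧ α (c • u + d • v) = 0 := by
    by_cases hu : α u = 0
    · exact ⟨0, -1, 1, 0, by simp, by simp [hu]⟩
    · exact ⟨1, 0, α v, -α u, by simpa using hu, by simp; ring⟩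
  have hne : c • u + d • v ≠ 0 :=
    ((LinearIndependent.pair_add_smul_add_smul_iff a b c d).2 ⟨huv, hdet⟩).ne_zero 1
  have hpos := hB.pos _ hne
  set r := B (a • u + b • v) (c • u + d • v) / B (c • u + d • v) (c • u + d • v) with hr
  refine ⟨a - r * c, b - r * d, c, d, fun h => hdet (by linear_combination h), hα, ?_⟩
  have : (a - r * c) • u + (b - r * d) • v = (a • u + b • v) - r • (c • u + d • v) := by module
  rw [this, map_sub, map_smul, sub_apply, smul_apply, smul_eq_mul, hr,
    div_mul_cancel₀ _ hpos.ne', sub_self]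

theorem stretchedForm_smul_add_smul_add (hB : IsInnerForm B) (hN : B N N = 1) (hu : B N u = 0)
    (hv : B N v = 0) (s t : ℝ) :
    stretchedForm B (B N) l (s • N + u) (t • N + v) = s * t / l ^ 2 + B u v := by
  simp only [stretchedForm_apply, map_add, map_smul, add_apply, smul_apply, smul_eq_mul, hN, hu,
    hv, hB.symm u N]
  ring

theorem le_sq_mul_stretchedForm (hB : IsInnerForm B) (hN : B N N = 1) (hl : 1 ≤ l) (u : E) :
    B u u ≤ l ^ 2 * stretchedForm B (B N) l u u := by
  have hNu : B N u ^ 2 ≤ B u u := by simpa [hN] using hB.apply_sq_le N u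
  have hl₁ : 1 ≤ l ^ 2 := one_le_pow₀ hl
  have : l ^ 2 * stretchedForm B (B N) l u u =
      B u u + (l ^ 2 - 1) * (B u u - B N u ^ 2) := by
    rw [stretchedForm_apply]
    field_simp
    ring
  rw [this]
  exact le_add_of_nonneg_right (mul_nonneg (by linarith) (by linarith))

protected theorem stretchedForm (hB : IsInnerForm B) (hN : B N N = 1) (hl : 1 ≤ l) :
    IsInnerForm (stretchedForm B (B N) l) where
  symm u v := by rw [stretchedForm_apply, stretchedForm_apply, hB.symm u v, mul_comm (B N u)]
  pos u hu := pos_of_mul_pos_right ((hB.pos u hu).trans_le (hB.le_sq_mul_stretchedForm hN hl u))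
    (sq_nonneg l)

end IsInnerForm

end InnerForms

section CurvatureOperators

variable {E : Type*} [NormedAddCommGroup E] [NormedSpace ℝ E]
  {B : E →L[ℝ] E →L[ℝ] ℝ} {R : E →L[ℝ] E →L[ℝ] E →L[ℝ] E} {n u v w : E} {Λ δ κ : ℝ}

/-- `R u v` has the two skew-symmetries of the curvature transformation `R(u, v)` of a metric
connection. -/
structure IsCurvatureOperator (B : E →L[ℝ] E →L[ℝ] ℝ) (R : E →L[ℝ] E →L[ℝ] E →L[ℝ] E) : Prop where
  swap : ∀ u v w, R u v w = -R v u w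
  apply_self : ∀ u v w, B (R u v w) w = 0

/-- The Jacobi form `(u, z) ↦ B (R(u, v) v) z` of the vector `v`. -/
def jacobiForm (B : E →L[ℝ] E →L[ℝ] ℝ) (R : E →L[ℝ] E →L[ℝ] E →L[ℝ] E) (v : E) :
    E →L[ℝ] E →L[ℝ] ℝ :=
  B.comp ((R.flip v).flip v)

/-- The sectional curvature of the plane spanned by `u` and `v`. -/
def formSectionalCurvature (B : E →L[ℝ] E →L[ℝ] ℝ) (R : E →L[ℝ] E →L[ℝ] E →L[ℝ] E) (u v : E) : ℝ :=
  jacobiForm B R v u u / (B u u * B v v - B u v ^ 2)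

theorem jacobiForm_apply (u v z : E) : jacobiForm B R v u z = B (R u v v) z := rfl

namespace IsCurvatureOperator

theorem apply_same (hR : IsCurvatureOperator B R) (u w : E) : R u u w = 0 := by
  have h := hR.swap u u w
  rwa [eq_neg_iff_add_eq_zero, ← two_smul ℝ, smul_eq_zero_iff_right two_ne_zero] at h

theorem apply_smul_add_smul (hR : IsCurvatureOperator B R) (u v w : E) (a b c d : ℝ) :
    R (a • u + b • v) (c • u + d • v) w = (a * d - b * c) • R u v w := by
  simp only [map_add, map_smul, add_apply, smul_apply, hR.apply_same, hR.swap v u w]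
  module

theorem apply_swap (hR : IsCurvatureOperator B R) (u v w z : E) :
    B (R u v w) z = -B (R u v z) w := by
  have h := hR.apply_self u v (w + z)
  simp only [map_add, add_apply, hR.apply_self] at h
  linarith

theorem formSectionalCurvature_smul_add_smul (hR : IsCurvatureOperator B R) (hB : IsInnerForm B)
    (u v : E) {a b c d : ℝ} (hdet : a * d ≠ b * c) :
    formSectionalCurvature B R (a • u + b • v) (c • u + d • v) =
      formSectionalCurvature B R u v := by
  have hnum : jacobiForm B R (c • u + d • v) (a • u + b • v) (a • u + b • v) =
      (a * d - b * c) ^ 2 * jacobiForm B R v u u := by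
    rw [jacobiForm_apply, jacobiForm_apply, hR.apply_smul_add_smul]
    simp only [map_add, map_smul, add_apply, smul_apply, smul_eq_mul, hR.apply_self,
      hR.apply_swap u v u v]
    ring
  have hden : B (a • u + b • v) (a • u + b • v) * B (c • u + d • v) (c • u + d • v)
      - B (a • u + b • v) (c • u + d • v) ^ 2 =
      (a * d - b * c) ^ 2 * (B u u * B v v - B u v ^ 2) := by
    simp only [map_add, map_smul, add_apply, smul_apply, smul_eq_mul, hB.symm v u]
    ring
  rw [formSectionalCurvature, formSectionalCurvature, hnum, hden,
    mul_div_mul_left _ _ (pow_ne_zero 2 (sub_ne_zero.2 hdet))]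

end IsCurvatureOperator

theorem formSectionalCurvature_of_orthogonal (huv : B u v = 0) :
    formSectionalCurvature B R u v = jacobiForm B R v u u / (B u u * B v v) := by
  simp [formSectionalCurvature, huv]

namespace IsInnerForm

theorem jacobiForm_self_le (hB : IsInnerForm B)
    (hK : LinearIndependent ℝ ![u, v] → formSectionalCurvature B R u v ≤ κ) (huv : B u v = 0) :
    jacobiForm B R v u u ≤ κ * (B u u * B v v) := by
  rcases eq_or_ne u 0 with rfl | hu
  · simp
  rcases eq_or_ne v 0 with rfl | hv
  · simp [jacobiForm_apply]
  have h := hK (hB.linearIndependent_of_orthogonal hu hv huv)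
  rwa [formSectionalCurvature_of_orthogonal huv,
    div_le_iff₀ (mul_pos (hB.pos u hu) (hB.pos v hv))] at h

theorem le_jacobiForm_self (hB : IsInnerForm B)
    (hK : LinearIndependent ℝ ![u, v] → κ ≤ formSectionalCurvature B R u v) (huv : B u v = 0) :
    κ * (B u u * B v v) ≤ jacobiForm B R v u u := by
  rcases eq_or_ne u 0 with rfl | hu
  · simp
  rcases eq_or_ne v 0 with rfl | hv
  · simp [jacobiForm_apply]
  have h := hK (hB.linearIndependent_of_orthogonal hu hv huv)
  rwa [formSectionalCurvature_of_orthogonal huv,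
    le_div_iff₀ (mul_pos (hB.pos u hu) (hB.pos v hv))] at h

/-- Since `jacobiForm B R v + (Λ * B v v) • B` is nonnegative on vectors orthogonal to `v`, its
mixed term is controlled by its diagonal terms. -/
theorem jacobiForm_add_self_le (hB : IsInnerForm B) (hΛ : 0 < Λ) (hδ : 0 < δ)
    (hK : ∀ u, LinearIndependent ℝ ![u, v] → |formSectionalCurvature B R u v| ≤ Λ)
    (hn : jacobiForm B R v n n ≤ -δ * (B n n * B v v))
    (hnv : B n v = 0) (hwv : B w v = 0) (hnw : B n w = 0) :
    jacobiForm B R v (n + w) (n + w) ≤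
      (-(δ / 2) * B n n + (Λ + 4 * Λ ^ 2 / δ) * B w w) * B v v := by
  set t := δ / (2 * Λ) with ht
  have ht₀ : 0 < t := by positivity
  have hw := hB.jacobiForm_self_le (fun h => (abs_le.1 (hK w h)).2) hwv
  have hnonneg : 0 ≤ (jacobiForm B R v + (Λ * B v v) • B) (t • n - w) (t • n - w) := by
    have h := hB.le_jacobiForm_self (fun h => (abs_le.1 (hK (t • n - w) h)).1)
      (by simp [hnv, hwv])
    rw [add_apply, add_apply, smul_apply, smul_apply, smul_eq_mul]
    linarith
  have hmix := bilin_add_self_le ht₀ hnonneg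
  have hgram : B (n + w) (n + w) = B n n + B w w := by simp [hnw, hB.symm w n]
  simp only [add_apply, smul_apply, smul_eq_mul, hgram] at hmix
  have hΛt : Λ * t = δ / 2 := by rw [ht]; field_simp
  have hΛt' : Λ * t⁻¹ = 2 * Λ ^ 2 / δ := by rw [ht]; field_simp
  have hn' : (1 + t) * (jacobiForm B R v n n + Λ * B v v * B n n) ≤
      (Λ - δ / 2) * (B n n * B v v) := by
    have := mul_le_mul_of_nonneg_left hn (add_pos one_pos ht₀).le
    have hnn := mul_nonneg (mul_nonneg hδ.le ht₀.le)
      (mul_nonneg (hB.apply_self_nonneg n) (hB.apply_self_nonneg v))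
    linear_combination this + hnn + (B n n * B v v) * hΛt
  have hw' : (1 + t⁻¹) * (jacobiForm B R v w w + Λ * B v v * B w w) ≤
      (2 * Λ + 4 * Λ ^ 2 / δ) * (B w w * B v v) := by
    have := mul_le_mul_of_nonneg_left hw (add_pos one_pos (inv_pos.2 ht₀)).le
    linear_combination this + 2 * (B w w * B v v) * hΛt'
  linear_combination hmix + hn' + hw'

end IsInnerForm

end CurvatureOperators

section StretchedCurvatureOperators

namespace IsInnerForm

variable {E : Type*} [NormedAddCommGroup E] [NormedSpace ℝ E]
  {B H : E →L[ℝ] E →L[ℝ] ℝ} {R R' : E →L[ℝ] E →L[ℝ] E →L[ℝ] E} {N : E} {l Λ δ c₁ c₂ : ℝ}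

theorem jacobiForm_sub_gram_det_bounds (hB : IsInnerForm B) (hN : B N N = 1)
    (hH : ∀ u v, H u v = H v u) (hc₁ : 0 < c₁)
    (hpinch : ∀ u, B N u = 0 → c₁ * B u u ≤ H u u ∧ H u u ≤ c₂ * B u u)
    (hΛ : 0 < Λ) (hδ : 0 < δ)
    (hK : ∀ u v, LinearIndependent ℝ ![u, v] → |formSectionalCurvature B R u v| ≤ Λ)
    (hKN : ∀ v, LinearIndependent ℝ ![N, v] → formSectionalCurvature B R N v ≤ -δ)
    (hl₁ : 1 ≤ l) (hl : Λ + 4 * Λ ^ 2 / δ + 1 ≤ (l ^ 2 - 1) * c₁ ^ 2) (s : ℝ) {v w : E}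
    (hv : B N v = 0) (hw : B N w = 0) (hwv : B w v = 0) :
    -(Λ * l ^ 2 + (l ^ 2 - 1) * c₂ ^ 2) * ((s ^ 2 / l ^ 2 + B w w) * B v v) ≤
        jacobiForm B R v (s • N + w) (s • N + w) - (l ^ 2 - 1) * (H w w * H v v - H w v ^ 2) ∧
      jacobiForm B R v (s • N + w) (s • N + w) - (l ^ 2 - 1) * (H w w * H v v - H w v ^ 2) ≤
        -min (δ / 2) 1 * ((s ^ 2 / l ^ 2 + B w w) * B v v) := by
  have hl₂ : 0 ≤ l ^ 2 - 1 := sub_nonneg.2 (one_le_pow₀ hl₁)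
  have hs₀ : 0 ≤ s ^ 2 / l ^ 2 := by positivity
  have hs : s ^ 2 = s ^ 2 / l ^ 2 * l ^ 2 := by field_simp
  have hV := hB.apply_self_nonneg v
  have hW := hB.apply_self_nonneg w
  have hNN : B (s • N) (s • N) = s ^ 2 := by simp [hN, sq]
  have hgram := hB.gram_det_bounds_of_pinched hH (S := (B N).ker) hc₁ hpinch hw hv hwv
  constructor
  · have h := hB.le_jacobiForm_self (u := s • N + w) (v := v) (fun h => (abs_le.1 (hK _ _ h)).1)
      (by simp [hv, hwv])
    rw [show B (s • N + w) (s • N + w) = s ^ 2 + B w w by simp [hN, hw, hB.symm w N, sq]] at h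
    have hΛW := mul_nonneg (mul_nonneg (mul_nonneg hΛ.le hl₂) hW) hV
    have hcs := mul_nonneg (mul_nonneg (mul_nonneg hl₂ (sq_nonneg c₂)) hs₀) hV
    linear_combination h + hΛW + hcs + mul_le_mul_of_nonneg_left hgram.2 hl₂ + Λ * B v v * hs
  · have hn : jacobiForm B R v (s • N) (s • N) ≤ -δ * (B (s • N) (s • N) * B v v) := by
      have h := mul_le_mul_of_nonneg_left (hB.jacobiForm_self_le (hKN v) hv) (sq_nonneg s)
      simp only [map_smul, smul_apply, smul_eq_mul]
      linear_combination h
    have h := hB.jacobiForm_add_self_le hΛ hδ (fun u => hK u v) hn (by simp [hv]) hwv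
      (by simp [hw])
    rw [hNN] at h
    have hsl : s ^ 2 / l ^ 2 ≤ s ^ 2 := div_le_self (sq_nonneg s) (one_le_pow₀ hl₁)
    have hmin₁ : min (δ / 2) 1 * (s ^ 2 / l ^ 2) ≤ δ / 2 * s ^ 2 :=
      mul_le_mul (min_le_left _ _) hsl hs₀ (by positivity)
    have hmin₂ : min (δ / 2) 1 * B w w ≤ 1 * B w w :=
      mul_le_mul_of_nonneg_right (min_le_right _ _) hW
    linear_combination h + mul_le_mul_of_nonneg_left hgram.1 hl₂
      + mul_le_mul_of_nonneg_right hl (mul_nonneg hW hV)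
      + mul_le_mul_of_nonneg_right hmin₁ hV + mul_le_mul_of_nonneg_right hmin₂ hV

theorem formSectionalCurvature_stretchedForm_bounds (hB : IsInnerForm B)
    (hN : B N N = 1) (hH : ∀ u v, H u v = H v u) (hHN : ∀ u, H u N = 0) (hc₁ : 0 < c₁)
    (hpinch : ∀ u, B N u = 0 → c₁ * B u u ≤ H u u ∧ H u u ≤ c₂ * B u u)
    (hΛ : 0 < Λ) (hδ : 0 < δ)
    (hK : ∀ u v, LinearIndependent ℝ ![u, v] → |formSectionalCurvature B R u v| ≤ Λ)
    (hKN : ∀ v, LinearIndependent ℝ ![N, v] → formSectionalCurvature B R N v ≤ -δ)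
    (hl₁ : 1 ≤ l) (hl : Λ + 4 * Λ ^ 2 / δ + 1 ≤ (l ^ 2 - 1) * c₁ ^ 2)
    (hR' : IsCurvatureOperator (stretchedForm B (B N) l) R')
    (hgauss : ∀ u v, jacobiForm (stretchedForm B (B N) l) R' v u u =
      jacobiForm B R v u u - (l ^ 2 - 1) * (H u u * H v v - H u v ^ 2))
    {u v : E} (huv : LinearIndependent ℝ ![u, v]) :
    -(Λ * l ^ 2 + (l ^ 2 - 1) * c₂ ^ 2) ≤ formSectionalCurvature (stretchedForm B (B N) l) R' u v ∧
      formSectionalCurvature (stretchedForm B (B N) l) R' u v ≤ -min (δ / 2) 1 := by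
  have hB' := hB.stretchedForm hN hl₁
  obtain ⟨a, b, c, d, hdet, hv, horth⟩ := hB'.exists_orthogonal_basis_apply_eq_zero (B N) huv
  have hli := (LinearIndependent.pair_add_smul_add_smul_iff a b c d).2 ⟨huv, hdet⟩
  have hu₀ := hB'.pos _ (hli.ne_zero 0)
  have hv₀ := hB'.pos _ (hli.ne_zero 1)
  rw [← hR'.formSectionalCurvature_smul_add_smul hB' u v hdet,
    formSectionalCurvature_of_orthogonal horth, hgauss]
  simp only [Matrix.cons_val_zero, Matrix.cons_val_one] at hu₀ hv₀
  rw [le_div_iff₀ (mul_pos hu₀ hv₀), div_le_iff₀ (mul_pos hu₀ hv₀)]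
  generalize c • u + d • v = v' at *
  obtain ⟨w, hw, hu'⟩ := exists_eq_smul_add hN (a • u + b • v)
  generalize B N (a • u + b • v) = s at hu'
  rw [hu'] at horth ⊢
  have hstretch (t : ℝ) (z : E) (hz : B N z = 0) :=
    hB.stretchedForm_smul_add_smul_add (l := l) hN hw hz s t
  have hvv := hB.stretchedForm_smul_add_smul_add (l := l) hN hv hv 0 0
  have hwv := hstretch 0 v' hv
  simp only [zero_smul, zero_add, mul_zero, zero_div] at hvv hwv
  have hHw (z : E) : H (s • N + w) z = H w z := by simp [hH N z, hHN]
  rw [hstretch s w hw, hvv, hHw, hHw, hH w (s • N + w), hHw, ← sq]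
  exact hB.jacobiForm_sub_gram_det_bounds hN hH hc₁ hpinch hΛ hδ hK hKN hl₁ hl s hv hw
    (hwv.symm.trans horth)

end IsInnerForm

end StretchedCurvatureOperators

section CoordinateConnection

variable {E : Type*} [NormedAddCommGroup E] [NormedSpace ℝ E]
  {G : E → E →L[ℝ] E →L[ℝ] ℝ} {U : Set E} {x : E}

theorem fderiv_apply_const {F F₁ : Type*} [NormedAddCommGroup F] [NormedSpace ℝ F]
    [NormedAddCommGroup F₁] [NormedSpace ℝ F₁] {A : E → F →L[ℝ] F₁}
    (hA : DifferentiableAt ℝ A x) (u : E) (v : F) :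
    fderiv ℝ (fun y => A y v) x u = fderiv ℝ A x u v := by
  rw [fderiv_clm_apply hA (differentiableAt_const v)]
  simp

theorem fderiv_apply_apply_const {F F₁ F₂ : Type*} [NormedAddCommGroup F] [NormedSpace ℝ F]
    [NormedAddCommGroup F₁] [NormedSpace ℝ F₁] [NormedAddCommGroup F₂] [NormedSpace ℝ F₂]
    {A : E → F →L[ℝ] F₁ →L[ℝ] F₂} (hA : DifferentiableAt ℝ A x) (u : E) (v : F) (w : F₁) :
    fderiv ℝ (fun y => A y v w) x u = fderiv ℝ A x u v w := by
  rw [fderiv_apply_const (hA.clm_apply (differentiableAt_const v)), fderiv_apply_const hA]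

theorem fderiv_fderiv_swap_of_contDiffAt {F : Type*} [NormedAddCommGroup F] [NormedSpace ℝ F]
    {f : E → F} (h : ContDiffAt ℝ ∞ f x) (u v : E) :
    fderiv ℝ (fderiv ℝ f) x u v = fderiv ℝ (fderiv ℝ f) x v u :=
  h.isSymmSndFDerivAt
    (by rw [minSmoothness_of_isRCLikeNormedField]; exact WithTop.coe_le_coe.mpr le_top) u v

/-- `christoffel G x` as a continuous bilinear map. -/
def christoffelMap (G : E → E →L[ℝ] E →L[ℝ] ℝ) (x : E) : E →L[ℝ] E →L[ℝ] E :=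
  let D := fderiv ℝ G x
  (ContinuousLinearMap.compL ℝ E (E →L[ℝ] ℝ) E (G x).inverse).comp
    ((1 / 2 : ℝ) • (D + D.flip -
      (ContinuousLinearMap.flipₗᵢ ℝ E E ℝ : (E →L[ℝ] E →L[ℝ] ℝ) →L[ℝ] _).comp D.flip))

theorem christoffelMap_apply (u v : E) : christoffelMap G x u v = christoffel G x u v := rfl

/-- The curvature tensor of `G` as a continuous trilinear map. -/
def curvatureOperator (G : E → E →L[ℝ] E →L[ℝ] ℝ) (x : E) : E →L[ℝ] E →L[ℝ] E →L[ℝ] E :=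
  let Γ := christoffelMap G x
  let D := fderiv ℝ (christoffelMap G) x
  let C := (ContinuousLinearMap.compL ℝ E E E).bilinearComp Γ Γ
  D - D.flip + C - C.flip

theorem curvatureOperator_apply (u v w : E) :
    curvatureOperator G x u v w =
      fderiv ℝ (christoffelMap G) x u v w - fderiv ℝ (christoffelMap G) x v u w
        + christoffelMap G x u (christoffelMap G x v w)
        - christoffelMap G x v (christoffelMap G x u w) := rfl

/-- `G` is a smooth pseudo-Riemannian metric on the open set `U`. -/
structure IsCoordMetricOn (G : E → E →L[ℝ] E →L[ℝ] ℝ) (U : Set E) : Prop where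
  isOpen : IsOpen U
  contDiffOn : ContDiffOn ℝ ∞ G U
  symm : ∀ x ∈ U, ∀ u v, G x u v = G x v u
  isInvertible : ∀ x ∈ U, (G x).IsInvertible

namespace IsCoordMetricOn

theorem contDiffAt (hG : IsCoordMetricOn G U) (hx : x ∈ U) : ContDiffAt ℝ ∞ G x :=
  hG.contDiffOn.contDiffAt (hG.isOpen.mem_nhds hx)

theorem differentiableAt (hG : IsCoordMetricOn G U) (hx : x ∈ U) : DifferentiableAt ℝ G x :=
  (hG.contDiffAt hx).differentiableAt (by simp)

theorem fderiv_symm (hG : IsCoordMetricOn G U) (hx : x ∈ U) (u v w : E) :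
    fderiv ℝ G x u v w = fderiv ℝ G x u w v := by
  have h : (fun y => G y v w) =ᶠ[𝓝 x] fun y => G y w v := by
    filter_upwards [hG.isOpen.mem_nhds hx] with y hy using hG.symm y hy v w
  rw [← fderiv_apply_apply_const (hG.differentiableAt hx), h.fderiv_eq,
    fderiv_apply_apply_const (hG.differentiableAt hx)]

theorem apply_inverse (hG : IsCoordMetricOn G U) (hx : x ∈ U) (α : E →L[ℝ] ℝ) :
    G x ((G x).inverse α) = α :=
  (hG.isInvertible x hx).self_apply_inverse α

theorem ext_left (hG : IsCoordMetricOn G U) (hx : x ∈ U) {u v : E}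
    (h : ∀ w, G x u w = G x v w) : u = v :=
  (hG.isInvertible x hx).injective (ContinuousLinearMap.ext h)

theorem apply_christoffelMap (hG : IsCoordMetricOn G U) (hx : x ∈ U) (u v w : E) :
    G x (christoffelMap G x u v) w =
      (fderiv ℝ G x u v w + fderiv ℝ G x v u w - fderiv ℝ G x w u v) / 2 := by
  rw [christoffelMap_apply, christoffel, hG.apply_inverse hx]
  simp [christoffelFirst]
  ring

theorem christoffelMap_symm (hG : IsCoordMetricOn G U) (hx : x ∈ U) (u v : E) :
    christoffelMap G x u v = christoffelMap G x v u := by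
  refine hG.ext_left hx fun w => ?_
  rw [hG.apply_christoffelMap hx, hG.apply_christoffelMap hx, hG.fderiv_symm hx w u v]
  ring

theorem fderiv_eq_christoffelMap (hG : IsCoordMetricOn G U) (hx : x ∈ U) (u v w : E) :
    fderiv ℝ G x u v w = G x (christoffelMap G x u v) w + G x v (christoffelMap G x u w) := by
  rw [hG.symm x hx v, hG.apply_christoffelMap hx, hG.apply_christoffelMap hx,
    hG.fderiv_symm hx u w v]
  ring

variable [CompleteSpace E]

theorem contDiffAt_inverse (hG : IsCoordMetricOn G U) (hx : x ∈ U) :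
    ContDiffAt ℝ ∞ (fun y => (G y).inverse) x := by
  obtain ⟨e, he⟩ := hG.isInvertible x hx
  have h := contDiffAt_map_inverse (𝕜 := ℝ) (n := ∞) e
  rw [he] at h
  exact h.comp x (hG.contDiffAt hx)

theorem contDiffAt_christoffelMap (hG : IsCoordMetricOn G U) (hx : x ∈ U) :
    ContDiffAt ℝ ∞ (christoffelMap G) x := by
  have hD : ContDiffAt ℝ ∞ (fderiv ℝ G) x := (hG.contDiffAt hx).fderiv_right (by simp)
  have hDflip : ContDiffAt ℝ ∞ (fun y => (fderiv ℝ G y).flip) x :=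
    (ContinuousLinearMap.flipₗᵢ ℝ E E (E →L[ℝ] ℝ)).contDiff.contDiffAt.comp x hD
  exact ((ContinuousLinearMap.contDiff _).contDiffAt.comp x (hG.contDiffAt_inverse hx)).clm_comp
    (((hD.add hDflip).sub (contDiffAt_const.clm_comp hDflip)).const_smul (1 / 2 : ℝ))

theorem differentiableAt_christoffelMap (hG : IsCoordMetricOn G U) (hx : x ∈ U) :
    DifferentiableAt ℝ (christoffelMap G) x :=
  (hG.contDiffAt_christoffelMap hx).differentiableAt (by simp)

theorem curvatureOperator_eq_riemannTensor (hG : IsCoordMetricOn G U) (hx : x ∈ U) (u v w : E) :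
    curvatureOperator G x u v w = riemannTensor G x u v w := by
  have hΓ := hG.differentiableAt_christoffelMap hx
  rw [curvatureOperator_apply, ← fderiv_apply_apply_const hΓ, ← fderiv_apply_apply_const hΓ]
  rfl

/-- Differentiate `G(w, w)` twice and use the symmetry of the second derivative. -/
theorem isCurvatureOperator (hG : IsCoordMetricOn G U) (hx : x ∈ U) :
    IsCurvatureOperator (G x) (curvatureOperator G x) where
  swap u v w := by simp only [curvatureOperator_apply]; abel
  apply_self u v w := by
    set Γ := christoffelMap G x with hΓx
    have hGx := hG.differentiableAt hx
    have hΓ := hG.differentiableAt_christoffelMap hx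
    have hsnd (a b : E) : fderiv ℝ (fderiv ℝ G) x a b w w =
        2 * (fderiv ℝ G x a (Γ b w) w + G x (fderiv ℝ (christoffelMap G) x a b w) w) := by
      have hDG : DifferentiableAt ℝ (fderiv ℝ G) x :=
        ((hG.contDiffAt hx).fderiv_right (by simp)).differentiableAt (n := ∞) (by simp)
      have h : (fun y => fderiv ℝ G y b w w) =ᶠ[𝓝 x]
          fun y => 2 * G y (christoffelMap G y b w) w := by
        filter_upwards [hG.isOpen.mem_nhds hx] with y hy
        rw [hG.fderiv_eq_christoffelMap hy, hG.symm y hy w]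
        ring
      rw [← fderiv_apply_const hDG, ← fderiv_apply_apply_const
        (hDG.clm_apply (differentiableAt_const b)), h.fderiv_eq, fderiv_const_mul (by fun_prop),
        fderiv_clm_apply (by fun_prop) (by fun_prop), fderiv_clm_apply (by fun_prop) (by fun_prop)]
      simp only [← hΓx, fderiv_fun_const, Pi.zero_apply, ContinuousLinearMap.comp_zero,
        ContinuousLinearMap.flip_add, add_apply, zero_add, smul_add, smul_apply,
        ContinuousLinearMap.flip_apply, ContinuousLinearMap.comp_apply,
        fderiv_apply_apply_const hΓ, smul_eq_mul]
      ring
    have hswap := congrArg (fun A : E →L[ℝ] E →L[ℝ] ℝ => A w w)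
      (fderiv_fderiv_swap_of_contDiffAt (hG.contDiffAt hx) u v)
    simp only [hsnd, hG.fderiv_eq_christoffelMap hx, ← hΓx] at hswap
    rw [hG.symm x hx (Γ v w) (Γ u w)] at hswap
    simp only [curvatureOperator_apply, map_add, map_sub, add_apply, sub_apply, ← hΓx]
    linarith

theorem coordSectionalCurvature_eq (hG : IsCoordMetricOn G U) (hx : x ∈ U) (u v : E) :
    coordSectionalCurvature G x u v = formSectionalCurvature (G x) (curvatureOperator G x) u v := by
  rw [formSectionalCurvature, jacobiForm_apply, hG.curvatureOperator_eq_riemannTensor hx]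
  rfl

end IsCoordMetricOn

end CoordinateConnection

section UnitGradient

variable {E : Type*} [NormedAddCommGroup E] [NormedSpace ℝ E]
  {G : E → E →L[ℝ] E →L[ℝ] ℝ} {φ : E → ℝ} {U : Set E} {x : E}

/-- The gradient of `φ` with respect to `G`. -/
def coordGrad (G : E → E →L[ℝ] E →L[ℝ] ℝ) (φ : E → ℝ) (x : E) : E :=
  (G x).inverse (fderiv ℝ φ x)

/-- The Hessian `∇dφ` of `φ` with respect to `G`. -/
def coordHessian (G : E → E →L[ℝ] E →L[ℝ] ℝ) (φ : E → ℝ) (x : E) : E →L[ℝ] E →L[ℝ] ℝ :=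
  fderiv ℝ (fderiv ℝ φ) x -
    (ContinuousLinearMap.compL ℝ E E ℝ (fderiv ℝ φ x)).comp (christoffelMap G x)

theorem coordHessian_apply (u v : E) :
    coordHessian G φ x u v =
      fderiv ℝ (fderiv ℝ φ) x u v - fderiv ℝ φ x (christoffelMap G x u v) := rfl

/-- The covariant derivative `u ↦ ∇_u grad φ` of the gradient of `φ`. -/
def covDerivGrad (G : E → E →L[ℝ] E →L[ℝ] ℝ) (φ : E → ℝ) (x : E) : E →L[ℝ] E :=
  fderiv ℝ (coordGrad G φ) x + (christoffelMap G x).flip (coordGrad G φ x)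

theorem covDerivGrad_apply (u : E) :
    covDerivGrad G φ x u =
      fderiv ℝ (coordGrad G φ) x u + christoffelMap G x u (coordGrad G φ x) := rfl

theorem IsCoordMetricOn.apply_coordGrad (hG : IsCoordMetricOn G U) (hx : x ∈ U) :
    G x (coordGrad G φ x) = fderiv ℝ φ x :=
  hG.apply_inverse hx _

theorem coordHessian_symm (hG : IsCoordMetricOn G U) (hφ : ContDiffAt ℝ ∞ φ x) (hx : x ∈ U)
    (u v : E) : coordHessian G φ x u v = coordHessian G φ x v u := by
  rw [coordHessian_apply, coordHessian_apply, hG.christoffelMap_symm hx u v,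
    fderiv_fderiv_swap_of_contDiffAt hφ]

/-- `φ` is a smooth function on `U` whose `G`-gradient has norm one. -/
structure IsUnitGradientOn (G : E → E →L[ℝ] E →L[ℝ] ℝ) (φ : E → ℝ) (U : Set E) : Prop where
  contDiffOn : ContDiffOn ℝ ∞ φ U
  apply_coordGrad : ∀ x ∈ U, fderiv ℝ φ x (coordGrad G φ x) = 1

theorem IsUnitGradientOn.contDiffAt (hφ : IsUnitGradientOn G φ U) (hG : IsCoordMetricOn G U)
    (hx : x ∈ U) : ContDiffAt ℝ ∞ φ x :=
  hφ.contDiffOn.contDiffAt (hG.isOpen.mem_nhds hx)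

variable [CompleteSpace E]

theorem contDiffAt_coordGrad (hG : IsCoordMetricOn G U) (hφ : ContDiffAt ℝ ∞ φ x) (hx : x ∈ U) :
    ContDiffAt ℝ ∞ (coordGrad G φ) x :=
  (hG.contDiffAt_inverse hx).clm_apply (hφ.fderiv_right (by simp))

theorem differentiableAt_coordGrad (hG : IsCoordMetricOn G U) (hφ : ContDiffAt ℝ ∞ φ x)
    (hx : x ∈ U) : DifferentiableAt ℝ (coordGrad G φ) x :=
  (contDiffAt_coordGrad hG hφ hx).differentiableAt (by simp)

theorem apply_covDerivGrad (hG : IsCoordMetricOn G U) (hφ : ContDiffAt ℝ ∞ φ x) (hx : x ∈ U)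
    (u z : E) : G x (covDerivGrad G φ x u) z = coordHessian G φ x u z := by
  have hDφ : DifferentiableAt ℝ (fderiv ℝ φ) x :=
    (hφ.fderiv_right (m := ∞) (by simp)).differentiableAt (by simp)
  have hGx := hG.differentiableAt hx
  have hgrad := differentiableAt_coordGrad hG hφ hx
  have h : (fun y => G y (coordGrad G φ y) z) =ᶠ[𝓝 x] fun y => fderiv ℝ φ y z := by
    filter_upwards [hG.isOpen.mem_nhds hx] with y hy using by rw [hG.apply_coordGrad hy]
  have hsum : G x (fderiv ℝ (coordGrad G φ) x u) z + fderiv ℝ G x u (coordGrad G φ x) z =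
      fderiv ℝ (fderiv ℝ φ) x u z := by
    rw [← fderiv_apply_const hDφ, ← h.fderiv_eq, fderiv_apply_const (hGx.clm_apply hgrad),
      fderiv_clm_apply hGx hgrad]
    rfl
  rw [hG.fderiv_eq_christoffelMap hx, hG.apply_coordGrad hx] at hsum
  rw [covDerivGrad_apply, coordHessian_apply, map_add, add_apply]
  linarith

theorem contDiffAt_coordHessian (hG : IsCoordMetricOn G U) (hφ : ContDiffAt ℝ ∞ φ x)
    (hx : x ∈ U) : ContDiffAt ℝ ∞ (coordHessian G φ) x := by
  have hDφ : ContDiffAt ℝ ∞ (fderiv ℝ φ) x := hφ.fderiv_right (by simp)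
  have hDDφ : ContDiffAt ℝ ∞ (fderiv ℝ (fderiv ℝ φ)) x := hDφ.fderiv_right (by simp)
  exact hDDφ.sub (((ContinuousLinearMap.contDiff _).contDiffAt.comp x hDφ).clm_comp
    (hG.contDiffAt_christoffelMap hx))

theorem differentiableAt_coordHessian (hG : IsCoordMetricOn G U) (hφ : ContDiffAt ℝ ∞ φ x)
    (hx : x ∈ U) : DifferentiableAt ℝ (coordHessian G φ) x :=
  (contDiffAt_coordHessian hG hφ hx).differentiableAt (by simp)

theorem fderiv_coordHessian_apply (hG : IsCoordMetricOn G U) (hφ : ContDiffAt ℝ ∞ φ x)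
    (hx : x ∈ U) (u v w : E) :
    fderiv ℝ (coordHessian G φ) x u v w = fderiv ℝ (fderiv ℝ (fderiv ℝ φ)) x u v w
      - fderiv ℝ (fderiv ℝ φ) x u (christoffelMap G x v w)
      - fderiv ℝ φ x (fderiv ℝ (christoffelMap G) x u v w) := by
  have hDφ : ContDiffAt ℝ ∞ (fderiv ℝ φ) x := hφ.fderiv_right (by simp)
  have hDDφ : ContDiffAt ℝ ∞ (fderiv ℝ (fderiv ℝ φ)) x := hDφ.fderiv_right (by simp)
  have hDφ₁ := hDφ.differentiableAt (by simp)
  have hDDφ₁ := hDDφ.differentiableAt (by simp)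
  have hΓ := hG.differentiableAt_christoffelMap hx
  have hHess : (fun y => coordHessian G φ y v w) =
      fun y => fderiv ℝ (fderiv ℝ φ) y v w - fderiv ℝ φ y (christoffelMap G y v w) := rfl
  rw [← fderiv_apply_apply_const (differentiableAt_coordHessian hG hφ hx), hHess,
    fderiv_fun_sub (by fun_prop) (by fun_prop), fderiv_clm_apply hDφ₁ (by fun_prop)]
  simp only [sub_apply, add_apply, ContinuousLinearMap.comp_apply, ContinuousLinearMap.flip_apply,
    fderiv_apply_apply_const hDDφ₁, fderiv_apply_apply_const hΓ]
  ring

theorem coordHessian_ricci_identity (hG : IsCoordMetricOn G U) (hφ : ContDiffAt ℝ ∞ φ x)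
    (hx : x ∈ U) (u v w : E) :
    fderiv ℝ (coordHessian G φ) x u v w - fderiv ℝ (coordHessian G φ) x v u w
      + coordHessian G φ x u (christoffelMap G x v w)
      - coordHessian G φ x v (christoffelMap G x u w) =
      -fderiv ℝ φ x (curvatureOperator G x u v w) := by
  rw [fderiv_coordHessian_apply hG hφ hx, fderiv_coordHessian_apply hG hφ hx,
    fderiv_fderiv_swap_of_contDiffAt (hφ.fderiv_right (m := ∞) (by simp)) u v]
  simp only [coordHessian_apply, curvatureOperator_apply, map_add, map_sub]
  ring

namespace IsUnitGradientOn

theorem coordHessian_coordGrad (hφ : IsUnitGradientOn G φ U) (hG : IsCoordMetricOn G U)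
    (hx : x ∈ U) (u : E) : coordHessian G φ x u (coordGrad G φ x) = 0 := by
  have hφx := hφ.contDiffAt hG hx
  have hDφ : DifferentiableAt ℝ (fderiv ℝ φ) x :=
    (hφx.fderiv_right (m := ∞) (by simp)).differentiableAt (by simp)
  have hgrad := differentiableAt_coordGrad hG hφx hx
  have hone : (fun y => fderiv ℝ φ y (coordGrad G φ y)) =ᶠ[𝓝 x] fun _ => 1 := by
    filter_upwards [hG.isOpen.mem_nhds hx] with y hy using hφ.apply_coordGrad y hy
  have hsum : fderiv ℝ φ x (fderiv ℝ (coordGrad G φ) x u)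
      + fderiv ℝ (fderiv ℝ φ) x u (coordGrad G φ x) = 0 := by
    have h := congrArg (fun A : E →L[ℝ] ℝ => A u) hone.fderiv_eq
    rw [fderiv_clm_apply hDφ hgrad] at h
    simpa using h
  have hcov := apply_covDerivGrad hG hφx hx u (coordGrad G φ x)
  rw [hG.symm x hx, hG.apply_coordGrad hx, covDerivGrad_apply, map_add] at hcov
  rw [coordHessian_apply] at hcov ⊢
  linarith

theorem fderiv_covDerivGrad (hφ : IsUnitGradientOn G φ U) (hG : IsCoordMetricOn G U)
    (hx : x ∈ U) (u : E) : fderiv ℝ φ x (covDerivGrad G φ x u) = 0 := by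
  rw [← hG.apply_coordGrad hx, hG.symm x hx, apply_covDerivGrad hG (hφ.contDiffAt hG hx) hx,
    hφ.coordHessian_coordGrad hG hx]

end IsUnitGradientOn

end UnitGradient

section CoordinateStretch

variable {E : Type*} [NormedAddCommGroup E] [NormedSpace ℝ E]
  {G Gh : E → E →L[ℝ] E →L[ℝ] ℝ} {φ : E → ℝ} {l : ℝ} {U : Set E} {x : E}

/-- `Gh` is the metric `G` stretched by `l` in the direction of the unit gradient field of `φ`. -/
structure IsCoordStretchOn (G Gh : E → E →L[ℝ] E →L[ℝ] ℝ) (φ : E → ℝ) (l : ℝ) (U : Set E) :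
    Prop where
  isCoordMetricOn : IsCoordMetricOn G U
  isCoordMetricOn_stretch : IsCoordMetricOn Gh U
  isUnitGradientOn : IsUnitGradientOn G φ U
  eq_stretchedForm : ∀ x ∈ U, Gh x = stretchedForm (G x) (fderiv ℝ φ x) l
  ne_zero : l ≠ 0

namespace IsCoordStretchOn

theorem contDiffAt (hs : IsCoordStretchOn G Gh φ l U) (hx : x ∈ U) : ContDiffAt ℝ ∞ φ x :=
  hs.isUnitGradientOn.contDiffAt hs.isCoordMetricOn hx

theorem apply_eq (hs : IsCoordStretchOn G Gh φ l U) (hx : x ∈ U) (u v : E) :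
    Gh x u v = G x u v - (1 - (l ^ 2)⁻¹) * (fderiv ℝ φ x u * fderiv ℝ φ x v) := by
  rw [hs.eq_stretchedForm x hx, stretchedForm_apply]

theorem fderiv_eq (hs : IsCoordStretchOn G Gh φ l U) (hx : x ∈ U) (u v w : E) :
    fderiv ℝ Gh x u v w = fderiv ℝ G x u v w - (1 - (l ^ 2)⁻¹) *
      (fderiv ℝ (fderiv ℝ φ) x u v * fderiv ℝ φ x w
        + fderiv ℝ φ x v * fderiv ℝ (fderiv ℝ φ) x u w) := by
  have hGx := hs.isCoordMetricOn.differentiableAt hx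
  have hDφ : DifferentiableAt ℝ (fderiv ℝ φ) x :=
    ((hs.contDiffAt hx).fderiv_right (m := ∞) (by simp)).differentiableAt (by simp)
  have h : (fun y => Gh y v w) =ᶠ[𝓝 x] fun y =>
      G y v w - (1 - (l ^ 2)⁻¹) * (fderiv ℝ φ y v * fderiv ℝ φ y w) := by
    filter_upwards [hs.isCoordMetricOn.isOpen.mem_nhds hx] with y hy using hs.apply_eq hy v w
  rw [← fderiv_apply_apply_const (hs.isCoordMetricOn_stretch.differentiableAt hx), h.fderiv_eq,
    fderiv_fun_sub (by fun_prop) (by fun_prop), fderiv_const_mul (by fun_prop),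
    fderiv_fun_mul (by fun_prop) (by fun_prop)]
  simp only [sub_apply, smul_apply, add_apply, smul_eq_mul, fderiv_apply_const hDφ,
    fderiv_apply_apply_const hGx]
  ring

theorem christoffelMap_eq (hs : IsCoordStretchOn G Gh φ l U) (hx : x ∈ U) (u v : E) :
    christoffelMap Gh x u v = christoffelMap G x u v
      - ((l ^ 2 - 1) * coordHessian G φ x u v) • coordGrad G φ x := by
  have hl := hs.ne_zero
  have hG := hs.isCoordMetricOn
  have hswap := fderiv_fderiv_swap_of_contDiffAt (hs.contDiffAt hx)
  refine hs.isCoordMetricOn_stretch.ext_left hx fun w => ?_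
  rw [hs.isCoordMetricOn_stretch.apply_christoffelMap hx, hs.apply_eq hx]
  simp only [hs.fderiv_eq hx, map_sub, map_smul, sub_apply, smul_apply, hG.apply_coordGrad hx,
    hs.isUnitGradientOn.apply_coordGrad x hx, hG.apply_christoffelMap hx, coordHessian_apply,
    smul_eq_mul]
  rw [hswap w u, hswap w v, hswap v u]
  field_simp
  ring

variable [CompleteSpace E]

theorem fderiv_christoffelMap_eq (hs : IsCoordStretchOn G Gh φ l U) (hx : x ∈ U) (u v w : E) :
    fderiv ℝ (christoffelMap Gh) x u v w = fderiv ℝ (christoffelMap G) x u v w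
      - ((l ^ 2 - 1) * fderiv ℝ (coordHessian G φ) x u v w) • coordGrad G φ x
      - ((l ^ 2 - 1) * coordHessian G φ x v w) • fderiv ℝ (coordGrad G φ) x u := by
  have hG := hs.isCoordMetricOn
  have hΓ := hG.differentiableAt_christoffelMap hx
  have hgrad := differentiableAt_coordGrad hG (hs.contDiffAt hx) hx
  have hHess := differentiableAt_coordHessian hG (hs.contDiffAt hx) hx
  have h : (fun y => christoffelMap Gh y v w) =ᶠ[𝓝 x] fun y => christoffelMap G y v w
      - ((l ^ 2 - 1) * coordHessian G φ y v w) • coordGrad G φ y := by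
    filter_upwards [hG.isOpen.mem_nhds hx] with y hy using hs.christoffelMap_eq hy v w
  rw [← fderiv_apply_apply_const (hs.isCoordMetricOn_stretch.differentiableAt_christoffelMap hx),
    h.fderiv_eq, fderiv_fun_sub (by fun_prop) (by fun_prop),
    fderiv_fun_smul (by fun_prop) (by fun_prop), fderiv_const_mul (by fun_prop)]
  simp only [sub_apply, add_apply, smul_apply, ContinuousLinearMap.smulRight_apply, smul_eq_mul,
    fderiv_apply_apply_const hHess, fderiv_apply_apply_const hΓ]
  module

/-- The terms with a derivative of the Hessian are collected by the Ricci identity. -/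
theorem curvatureOperator_eq (hs : IsCoordStretchOn G Gh φ l U) (hx : x ∈ U) (u v w : E) :
    curvatureOperator Gh x u v w = curvatureOperator G x u v w
      + ((l ^ 2 - 1) * fderiv ℝ φ x (curvatureOperator G x u v w)) • coordGrad G φ x
      - ((l ^ 2 - 1) * coordHessian G φ x v w) • covDerivGrad G φ x u
      + ((l ^ 2 - 1) * coordHessian G φ x u w) • covDerivGrad G φ x v := by
  have hG := hs.isCoordMetricOn
  rw [← neg_eq_iff_eq_neg.mpr (coordHessian_ricci_identity hG (hs.contDiffAt hx) hx u v w),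
    curvatureOperator_apply, curvatureOperator_apply, hs.fderiv_christoffelMap_eq hx,
    hs.fderiv_christoffelMap_eq hx]
  simp only [hs.christoffelMap_eq hx, covDerivGrad_apply, map_sub, map_smul, smul_eq_mul,
    hs.isUnitGradientOn.coordHessian_coordGrad hG hx]
  module

/-- The Gauss equation of the level sets of `φ`, whose second fundamental form for `Gh` is
`l * coordHessian G φ x`, with the term of `G` subtracted. -/
theorem apply_curvatureOperator_eq (hs : IsCoordStretchOn G Gh φ l U) (hx : x ∈ U)
    (u v w z : E) :
    Gh x (curvatureOperator Gh x u v w) z = G x (curvatureOperator G x u v w) z - (l ^ 2 - 1) *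
      (coordHessian G φ x v w * coordHessian G φ x u z
        - coordHessian G φ x u w * coordHessian G φ x v z) := by
  have hl := hs.ne_zero
  have hG := hs.isCoordMetricOn
  have hφ := hs.isUnitGradientOn
  rw [hs.curvatureOperator_eq hx, hs.apply_eq hx]
  simp only [map_add, map_sub, map_smul, add_apply, sub_apply, smul_apply, smul_eq_mul,
    hG.apply_coordGrad hx, hφ.apply_coordGrad x hx, hφ.fderiv_covDerivGrad hG hx,
    apply_covDerivGrad hG (hs.contDiffAt hx) hx]
  field_simp
  ring

theorem jacobiForm_self_eq (hs : IsCoordStretchOn G Gh φ l U) (hx : x ∈ U) (u v : E) :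
    jacobiForm (Gh x) (curvatureOperator Gh x) v u u =
      jacobiForm (G x) (curvatureOperator G x) v u u - (l ^ 2 - 1) *
        (coordHessian G φ x u u * coordHessian G φ x v v - coordHessian G φ x u v ^ 2) := by
  rw [jacobiForm_apply, hs.apply_curvatureOperator_eq hx, jacobiForm_apply,
    coordHessian_symm hs.isCoordMetricOn (hs.contDiffAt hx) hx v u]
  ring

end IsCoordStretchOn

end CoordinateStretch

section CoordinatePinching

variable {E : Type*} [NormedAddCommGroup E] [NormedSpace ℝ E] [CompleteSpace E]
  {G Gh : E → E →L[ℝ] E →L[ℝ] ℝ} {φ : E → ℝ} {l Λ δ c₁ c₂ : ℝ} {U : Set E} {x : E}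

theorem IsCoordStretchOn.coordSectionalCurvature_bounds (hs : IsCoordStretchOn G Gh φ l U)
    (hx : x ∈ U) (hB : IsInnerForm (G x)) (hc₁ : 0 < c₁)
    (hpinch : ∀ u, fderiv ℝ φ x u = 0 →
      c₁ * G x u u ≤ coordHessian G φ x u u ∧ coordHessian G φ x u u ≤ c₂ * G x u u)
    (hΛ : 0 < Λ) (hδ : 0 < δ)
    (hK : ∀ u v, LinearIndependent ℝ ![u, v] → |coordSectionalCurvature G x u v| ≤ Λ)
    (hKN : ∀ v, LinearIndependent ℝ ![coordGrad G φ x, v] →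
      coordSectionalCurvature G x (coordGrad G φ x) v ≤ -δ)
    (hl₁ : 1 ≤ l) (hl : Λ + 4 * Λ ^ 2 / δ + 1 ≤ (l ^ 2 - 1) * c₁ ^ 2)
    {u v : E} (huv : LinearIndependent ℝ ![u, v]) :
    -(Λ * l ^ 2 + (l ^ 2 - 1) * c₂ ^ 2) ≤ coordSectionalCurvature Gh x u v ∧
      coordSectionalCurvature Gh x u v ≤ -min (δ / 2) 1 := by
  have hG := hs.isCoordMetricOn
  have hGh := hs.isCoordMetricOn_stretch
  have hφ := hs.isUnitGradientOn
  have hgrad : G x (coordGrad G φ x) = fderiv ℝ φ x := hG.apply_coordGrad hx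
  have hGhx : Gh x = stretchedForm (G x) (G x (coordGrad G φ x)) l := by
    rw [hgrad, hs.eq_stretchedForm x hx]
  simp only [hG.coordSectionalCurvature_eq hx] at hK hKN
  rw [hGh.coordSectionalCurvature_eq hx, hGhx]
  refine hB.formSectionalCurvature_stretchedForm_bounds (H := coordHessian G φ x)
    ?_ (coordHessian_symm hG (hs.contDiffAt hx) hx) (hφ.coordHessian_coordGrad hG hx) hc₁
    ?_ hΛ hδ hK hKN hl₁ hl ?_ ?_ huv
  · rw [hgrad, hφ.apply_coordGrad x hx]
  · simpa only [hgrad] using hpinch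
  · exact hGhx ▸ hGh.isCurvatureOperator hx
  · exact hGhx ▸ hs.jacobiForm_self_eq hx

end CoordinatePinching

section CoordinateGeodesics

variable {E : Type*} [NormedAddCommGroup E] [NormedSpace ℝ E]
  {G : E → E →L[ℝ] E →L[ℝ] ℝ} {φ : E → ℝ} {U : Set E} {x : E} {ε t : ℝ} {γ y : ℝ → E}

/-- `γ` with velocity `y` solves the geodesic equation of `G` in `U` on `(-ε, ε)`. -/
structure IsCoordGeodesic (G : E → E →L[ℝ] E →L[ℝ] ℝ) (U : Set E) (ε : ℝ) (γ y : ℝ → E) :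
    Prop where
  mem : ∀ t ∈ Set.Ioo (-ε) ε, γ t ∈ U
  hasDerivAt : ∀ t ∈ Set.Ioo (-ε) ε, HasDerivAt γ (y t) t
  hasDerivAt_velocity : ∀ t ∈ Set.Ioo (-ε) ε,
    HasDerivAt y (-christoffelMap G (γ t) (y t) (y t)) t

theorem IsCoordMetricOn.exists_isCoordGeodesic [CompleteSpace E] (hG : IsCoordMetricOn G U)
    (hx : x ∈ U) (u : E) :
    ∃ ε > 0, ∃ γ y : ℝ → E, γ 0 = x ∧ y 0 = u ∧ IsCoordGeodesic G U ε γ y := by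
  have hF : ContDiffAt ℝ ∞ (fun p : E × E => (p.2, -christoffelMap G p.1 p.2 p.2)) (x, u) :=
    contDiffAt_snd.prodMk (((((hG.contDiffAt_christoffelMap hx).comp (x, u)
      contDiffAt_fst).clm_apply contDiffAt_snd).clm_apply contDiffAt_snd).neg)
  obtain ⟨α, hα₀, ε, hε, hα⟩ := (hF.of_le (m := 1)
    (by simp)).exists_forall_mem_closedBall_exists_eq_forall_mem_Ioo_hasDerivAt₀ 0
  have hmem : ∀ᶠ t in 𝓝 (0 : ℝ), (α t).1 ∈ U := by
    refine (continuous_fst.continuousAt.comp (hα 0 (by simp [hε])).continuousAt).eventually ?_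
    simpa [hα₀] using hG.isOpen.mem_nhds hx
  obtain ⟨r, hr, hrU⟩ := Metric.eventually_nhds_iff.1 hmem
  have hsub {t : ℝ} (ht : t ∈ Set.Ioo (-min ε r) (min ε r)) :
      t ∈ Set.Ioo (0 - ε) (0 + ε) ∧ dist t 0 < r := by
    rw [Set.mem_Ioo, ← abs_lt, lt_min_iff] at ht
    simpa [Real.dist_eq, ← abs_lt] using ht
  exact ⟨min ε r, lt_min hε hr, fun t => (α t).1, fun t => (α t).2, by simp [hα₀], by simp [hα₀],
    fun t ht => hrU (hsub ht).2, fun t ht => (hα t (hsub ht).1).fst,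
    fun t ht => (hα t (hsub ht).1).snd⟩

namespace IsCoordGeodesic

theorem deriv_eventuallyEq (h : IsCoordGeodesic G U ε γ y) (ht : t ∈ Set.Ioo (-ε) ε) :
    deriv γ =ᶠ[𝓝 t] y := by
  filter_upwards [isOpen_Ioo.mem_nhds ht] with s hs using (h.hasDerivAt s hs).deriv

theorem deriv_deriv (h : IsCoordGeodesic G U ε γ y) (ht : t ∈ Set.Ioo (-ε) ε) :
    deriv (deriv γ) t = -christoffelMap G (γ t) (y t) (y t) := by
  rw [(h.deriv_eventuallyEq ht).deriv_eq, (h.hasDerivAt_velocity t ht).deriv]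

theorem contDiffOn [CompleteSpace E] (h : IsCoordGeodesic G U ε γ y) (hG : IsCoordMetricOn G U) :
    ContDiffOn ℝ 2 γ (Set.Ioo (-ε) ε) := by
  have hacc : ContinuousOn (fun t => -christoffelMap G (γ t) (y t) (y t)) (Set.Ioo (-ε) ε) := by
    intro t ht
    have hΓ : ContinuousAt (fun t => christoffelMap G (γ t)) t :=
      (hG.contDiffAt_christoffelMap (h.mem t ht)).continuousAt.comp (h.hasDerivAt t ht).continuousAt
    have hy := (h.hasDerivAt_velocity t ht).continuousAt
    exact ((hΓ.clm_apply hy).clm_apply hy).neg.continuousWithinAt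
  have hvel : ContDiffOn ℝ 1 y (Set.Ioo (-ε) ε) := by
    rw [show (1 : WithTop ℕ∞) = 0 + 1 from rfl, contDiffOn_succ_iff_deriv_of_isOpen isOpen_Ioo,
      contDiffOn_zero]
    exact ⟨fun t ht => (h.hasDerivAt_velocity t ht).differentiableAt.differentiableWithinAt,
      by simp, hacc.congr fun t ht => (h.hasDerivAt_velocity t ht).deriv⟩
  rw [show (2 : WithTop ℕ∞) = 1 + 1 from rfl, contDiffOn_succ_iff_deriv_of_isOpen isOpen_Ioo]
  exact ⟨fun t ht => (h.hasDerivAt t ht).differentiableAt.differentiableWithinAt, by simp,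
    hvel.congr fun t ht => (h.hasDerivAt t ht).deriv⟩

theorem speed_eq (h : IsCoordGeodesic G U ε γ y) (hG : IsCoordMetricOn G U)
    (ht : t ∈ Set.Ioo (-ε) ε) : G (γ t) (y t) (y t) = G (γ 0) (y 0) (y 0) := by
  have hderiv (s : ℝ) (hs : s ∈ Set.Ioo (-ε) ε) :
      HasDerivAt (fun s => G (γ s) (y s) (y s)) 0 s := by
    have hGγ : HasDerivAt (fun s => G (γ s)) (fderiv ℝ G (γ s) (y s)) s :=
      (hG.differentiableAt (h.mem s hs)).hasFDerivAt.comp_hasDerivAt s (h.hasDerivAt s hs)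
    have hy := h.hasDerivAt_velocity s hs
    refine ((hGγ.clm_apply hy).clm_apply hy).congr_deriv ?_
    simp only [map_neg, add_apply, neg_apply, hG.fderiv_eq_christoffelMap (h.mem s hs)]
    ring
  exact isOpen_Ioo.is_const_of_deriv_eq_zero isPreconnected_Ioo
    (fun s hs => (hderiv s hs).differentiableAt.differentiableWithinAt)
    (fun s hs => (hderiv s hs).deriv) ht (by constructor <;> linarith [ht.1, ht.2])

theorem deriv_deriv_comp (h : IsCoordGeodesic G U ε γ y) (hU : IsOpen U)
    (hφ : ContDiffOn ℝ ∞ φ U) (ht : t ∈ Set.Ioo (-ε) ε) :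
    deriv (deriv (φ ∘ γ)) t = coordHessian G φ (γ t) (y t) (y t) := by
  have hφγ (s : ℝ) (hs : s ∈ Set.Ioo (-ε) ε) : ContDiffAt ℝ ∞ φ (γ s) :=
    hφ.contDiffAt (hU.mem_nhds (h.mem s hs))
  have hderiv : deriv (φ ∘ γ) =ᶠ[𝓝 t] fun s => fderiv ℝ φ (γ s) (y s) := by
    filter_upwards [isOpen_Ioo.mem_nhds ht] with s hs
    exact (((hφγ s hs).differentiableAt (by simp)).hasFDerivAt.comp_hasDerivAt s
      (h.hasDerivAt s hs)).deriv
  have hDφ : HasDerivAt (fun s => fderiv ℝ φ (γ s)) (fderiv ℝ (fderiv ℝ φ) (γ t) (y t)) t :=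
    (((hφγ t ht).fderiv_right (m := ∞) (by simp)).differentiableAt
      (by simp)).hasFDerivAt.comp_hasDerivAt t (h.hasDerivAt t ht)
  rw [hderiv.deriv_eq, (hDφ.clm_apply (h.hasDerivAt_velocity t ht)).deriv, coordHessian_apply,
    map_neg, sub_eq_add_neg]

end IsCoordGeodesic

end CoordinateGeodesics

section SmoothSections

variable {E : Type*} [NormedAddCommGroup E] [NormedSpace ℝ E]
  {Y : Type*} [TopologicalSpace Y] [ChartedSpace E Y] {p : Y}

theorem contMDiffAt_of_forall_apply {F : Type*} [NormedAddCommGroup F] [NormedSpace ℝ F]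
    [FiniteDimensional ℝ E] {n : WithTop ℕ∞} {A : Y → E →L[ℝ] F}
    (h : ∀ u, ContMDiffAt 𝓘(ℝ, E) 𝓘(ℝ, F) n (fun y => A y u) p) :
    ContMDiffAt 𝓘(ℝ, E) 𝓘(ℝ, E →L[ℝ] F) n A p := by
  let e := ((ContinuousLinearEquiv.ofFinrankEq (Module.finrank_fin_fun ℝ).symm :
    E ≃L[ℝ] (Fin (Module.finrank ℝ E) → ℝ)).arrowCongr (.refl ℝ F)).trans
      (ContinuousLinearEquiv.piRing _)
  rw [← Function.id_comp A, ← e.symm_comp_self]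
  exact e.symm.contDiff.contMDiff.contMDiffAt.comp p (contMDiffAt_pi_space.mpr fun i => h _)

variable [IsManifold 𝓘(ℝ, E) ∞ Y]

theorem contMDiffAt_trivializationAt_symm {q : Y} (hp : p ∈ (chartAt E q).source) (u : E) :
    ContMDiffAt 𝓘(ℝ, E) 𝓘(ℝ, E).tangent ∞
      (fun y => (⟨y, (trivializationAt E (TangentSpace 𝓘(ℝ, E)) q).symm y u⟩ :
        TangentBundle 𝓘(ℝ, E) Y)) p := by
  set e := trivializationAt E (TangentSpace 𝓘(ℝ, E) : Y → Type _) q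
  have hbase : e.baseSet = (chartAt E q).source := TangentBundle.trivializationAt_baseSet q
  have hsymm : ContMDiffAt (𝓘(ℝ, E).prod 𝓘(ℝ, E)) (𝓘(ℝ, E).prod 𝓘(ℝ, E)) ∞
      e.toOpenPartialHomeomorph.symm (p, u) :=
    (e.contMDiffOn_symm (IB := 𝓘(ℝ, E)) (n := ∞)).contMDiffAt
      (e.open_target.mem_nhds (by rwa [e.mem_target, hbase]))
  refine (hsymm.comp p (contMDiffAt_id.prodMk contMDiffAt_const)).congr_of_eventuallyEq ?_
  filter_upwards [(chartAt E q).open_source.mem_nhds hp] with y hy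
  exact e.mk_symm (by rwa [hbase]) u

theorem contMDiffAt_inner_apply (g : SmoothMetric E Y) {s t : ∀ y : Y, TangentSpace 𝓘(ℝ, E) y}
    (hs : ContMDiffAt 𝓘(ℝ, E) 𝓘(ℝ, E).tangent ∞
      (fun y => (⟨y, s y⟩ : TangentBundle 𝓘(ℝ, E) Y)) p)
    (ht : ContMDiffAt 𝓘(ℝ, E) 𝓘(ℝ, E).tangent ∞
      (fun y => (⟨y, t y⟩ : TangentBundle 𝓘(ℝ, E) Y)) p) :
    ContMDiffAt 𝓘(ℝ, E) 𝓘(ℝ, ℝ) ∞ (fun y => g.inner y (s y) (t y)) p := by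
  have h : ContMDiffAt 𝓘(ℝ, E) (𝓘(ℝ, E).prod 𝓘(ℝ)) ∞
      (fun y => Bundle.TotalSpace.mk' ℝ (E := Bundle.Trivial Y ℝ) y (g.inner y (s y) (t y))) p :=
    ContMDiffAt.clm_bundle_apply₂ (F₁ := E) (F₂ := E) g.contMDiff.contMDiffAt hs ht
  exact (Bundle.contMDiffAt_totalSpace.1 h).2

theorem contMDiffAt_mfderiv_apply {f : Y → ℝ} (hf : ContMDiff 𝓘(ℝ, E) 𝓘(ℝ, ℝ) ∞ f)
    {s : ∀ y : Y, TangentSpace 𝓘(ℝ, E) y}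
    (hs : ContMDiffAt 𝓘(ℝ, E) 𝓘(ℝ, E).tangent ∞
      (fun y => (⟨y, s y⟩ : TangentBundle 𝓘(ℝ, E) Y)) p) :
    ContMDiffAt 𝓘(ℝ, E) 𝓘(ℝ, ℝ) ∞ (fun y => (mfderiv 𝓘(ℝ, E) 𝓘(ℝ, ℝ) f y (s y) : ℝ)) p :=
  (contMDiff_snd_tangentBundle_modelSpace ℝ 𝓘(ℝ, ℝ)).contMDiffAt.comp p
    ((hf.contMDiff_tangentMap (m := ∞) (by simp)).contMDiffAt.comp p hs)

theorem contMDiffAt_bilin_section [FiniteDimensional ℝ E]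
    (B : ∀ y : Y, TangentSpace 𝓘(ℝ, E) y →L[ℝ] TangentSpace 𝓘(ℝ, E) y →L[ℝ] ℝ)
    (hB : ∀ u v : E, ContMDiffAt 𝓘(ℝ, E) 𝓘(ℝ, ℝ) ∞
      (fun y => B y ((trivializationAt E (TangentSpace 𝓘(ℝ, E)) p).symm y u)
        ((trivializationAt E (TangentSpace 𝓘(ℝ, E)) p).symm y v)) p) :
    ContMDiffAt 𝓘(ℝ, E) (𝓘(ℝ, E).prod 𝓘(ℝ, E →L[ℝ] E →L[ℝ] ℝ)) ∞
      (fun y => Bundle.TotalSpace.mk' (E →L[ℝ] E →L[ℝ] ℝ)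
        (E := fun y : Y => TangentSpace 𝓘(ℝ, E) y →L[ℝ] TangentSpace 𝓘(ℝ, E) y →L[ℝ] ℝ)
        y (B y)) p := by
  refine (contMDiffAt_hom_bundle _).2 ⟨contMDiffAt_id, ?_⟩
  refine contMDiffAt_of_forall_apply fun u => contMDiffAt_of_forall_apply fun v => ?_
  refine (hB u v).congr_of_eventuallyEq ?_
  filter_upwards [(chartAt E p).open_source.mem_nhds (mem_chart_source E p)] with y hy
  refine (inCoordinates_apply_eq₂ (E₃ := Bundle.Trivial Y ℝ) hy hy (by simp)).trans ?_
  simp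

end SmoothSections

section Charts

variable {E : Type*} [NormedAddCommGroup E] [NormedSpace ℝ E]
  {Y : Type*} [TopologicalSpace Y] [ChartedSpace E Y] {q : Y} {x : E}

/-- The derivative at `x` of the inverse of the chart around `q`. -/
def chartInvDeriv (q : Y) (x : E) : E →L[ℝ] E :=
  mfderiv 𝓘(ℝ, E) 𝓘(ℝ, E) (extChartAt 𝓘(ℝ, E) q).symm x

theorem chartInvDeriv_eq_mfderivWithin (q : Y) (x : E) :
    chartInvDeriv q x =
      mfderivWithin 𝓘(ℝ, E) 𝓘(ℝ, E) (extChartAt 𝓘(ℝ, E) q).symm (Set.range 𝓘(ℝ, E)) x := by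
  rw [modelWithCornersSelf_coe, Set.range_id, mfderivWithin_univ]
  rfl

theorem extChartAt_symm_mem_source (hx : x ∈ (extChartAt 𝓘(ℝ, E) q).target) :
    (extChartAt 𝓘(ℝ, E) q).symm x ∈ (chartAt E q).source := by
  rw [← extChartAt_source 𝓘(ℝ, E)]
  exact (extChartAt 𝓘(ℝ, E) q).map_target hx

variable [IsManifold 𝓘(ℝ, E) ∞ Y]

theorem contMDiffAt_extChartAt_symm (hx : x ∈ (extChartAt 𝓘(ℝ, E) q).target) :
    ContMDiffAt 𝓘(ℝ, E) 𝓘(ℝ, E) ∞ (extChartAt 𝓘(ℝ, E) q).symm x :=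
  (contMDiffOn_extChartAt_symm q).contMDiffAt ((isOpen_extChartAt_target q).mem_nhds hx)

theorem isInvertible_chartInvDeriv (hx : x ∈ (extChartAt 𝓘(ℝ, E) q).target) :
    (chartInvDeriv q x).IsInvertible := by
  have : IsManifold 𝓘(ℝ, E) 1 Y := .of_le (n := ∞) (by simp)
  rw [chartInvDeriv_eq_mfderivWithin]
  exact isInvertible_mfderivWithin_extChartAt_symm hx

theorem chartInvDeriv_apply (hx : x ∈ (extChartAt 𝓘(ℝ, E) q).target) (u : E) :
    chartInvDeriv q x u = (trivializationAt E (TangentSpace 𝓘(ℝ, E)) q).symm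
      ((extChartAt 𝓘(ℝ, E) q).symm x) u := by
  have : IsManifold 𝓘(ℝ, E) 1 Y := .of_le (n := ∞) (by simp)
  have h := TangentBundle.symmL_trivializationAt (I := 𝓘(ℝ, E)) (extChartAt_symm_mem_source hx)
  rw [(extChartAt 𝓘(ℝ, E) q).right_inv hx] at h
  rw [chartInvDeriv_eq_mfderivWithin, ← Bundle.Trivialization.symmL_apply (R := ℝ)
    (hb := extChartAt_symm_mem_source hx)]
  exact (congrArg (fun A : E →L[ℝ] E => A u) h).symm

theorem chartInvDeriv_self (p : Y) :
    chartInvDeriv p (extChartAt 𝓘(ℝ, E) p p) = ContinuousLinearMap.id ℝ E := by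
  have : IsManifold 𝓘(ℝ, E) 1 Y := .of_le (n := ∞) (by simp)
  rw [chartInvDeriv_eq_mfderivWithin]
  exact mfderivWithin_range_extChartAt_symm

theorem sectionalCurvature_eq (g : SmoothMetric E Y) (p : Y) (u v : E) :
    sectionalCurvature g p u v =
      coordSectionalCurvature (coordMetric g p) (extChartAt 𝓘(ℝ, E) p p) u v := by
  have : IsManifold 𝓘(ℝ, E) 1 Y := .of_le (n := ∞) (by simp)
  have hid (w : E) : mfderiv 𝓘(ℝ, E) 𝓘(ℝ, E) (extChartAt 𝓘(ℝ, E) p) p w = w :=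
    congrArg (fun A : E →L[ℝ] E => A w) mfderiv_extChartAt_self
  exact congrArg₂ (coordSectionalCurvature (coordMetric g p) (extChartAt 𝓘(ℝ, E) p p))
    (hid u) (hid v)

end Charts

section MetricsInCharts

variable {E : Type*} [NormedAddCommGroup E] [NormedSpace ℝ E]
  {Y : Type*} [TopologicalSpace Y] [ChartedSpace E Y]

/-- The differential of `f` at `p`, on the model space, to which every tangent space reduces
definitionally. -/
def differentialAt (f : Y → ℝ) (p : Y) : E →L[ℝ] ℝ := mfderiv 𝓘(ℝ, E) 𝓘(ℝ, ℝ) f p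

/-- The function `f` in the chart around `q`. It is relevant on the image of the chart. -/
def coordFun (f : Y → ℝ) (q : Y) : E → ℝ := f ∘ (extChartAt 𝓘(ℝ, E) q).symm

variable [IsManifold 𝓘(ℝ, E) ∞ Y] {g : SmoothMetric E Y} {f : Y → ℝ} {q : Y} {x : E}

/-- The inner product of `g` at `p`, on the model space. -/
def innerAt (g : SmoothMetric E Y) (p : Y) : E →L[ℝ] E →L[ℝ] ℝ := g.inner p

/-- The gradient of `f` at `p`, on the model space. -/
def gradAt (g : SmoothMetric E Y) (f : Y → ℝ) (p : Y) : E := riemGrad g f p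

/-- The metric `h^l = g - (1 - l⁻²) df ⊗ df` at `p`, on the model space. -/
def stretchedFormAt (g : SmoothMetric E Y) (f : Y → ℝ) (l : ℝ) (p : Y) : E →L[ℝ] E →L[ℝ] ℝ :=
  stretchedForm (innerAt g p) (differentialAt f p) l

theorem coordMetric_apply (u v : E) :
    coordMetric g q x u v = innerAt g ((extChartAt 𝓘(ℝ, E) q).symm x) (chartInvDeriv q x u)
      (chartInvDeriv q x v) := rfl

theorem isInnerForm_innerAt (g : SmoothMetric E Y) (p : Y) : IsInnerForm (innerAt g p) where
  symm := g.symm p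
  pos := g.pos p

theorem isInnerForm_coordMetric (g : SmoothMetric E Y)
    (hx : x ∈ (extChartAt 𝓘(ℝ, E) q).target) : IsInnerForm (coordMetric g q x) where
  symm u v := by rw [coordMetric_apply, coordMetric_apply, (isInnerForm_innerAt g _).symm]
  pos u hu := by
    rw [coordMetric_apply]
    refine (isInnerForm_innerAt g _).pos _ fun h => hu ?_
    exact (isInvertible_chartInvDeriv hx).injective (h.trans (map_zero _).symm)

theorem contDiffOn_coordFun (hf : ContMDiff 𝓘(ℝ, E) 𝓘(ℝ, ℝ) ∞ f) (q : Y) :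
    ContDiffOn ℝ ∞ (coordFun f q) (extChartAt 𝓘(ℝ, E) q).target := fun x hx =>
  (hf.contMDiffAt.comp x (contMDiffAt_extChartAt_symm hx)).contDiffAt.contDiffWithinAt

theorem fderiv_coordFun (hf : ContMDiff 𝓘(ℝ, E) 𝓘(ℝ, ℝ) ∞ f)
    (hx : x ∈ (extChartAt 𝓘(ℝ, E) q).target) :
    fderiv ℝ (coordFun f q) x =
      (differentialAt f ((extChartAt 𝓘(ℝ, E) q).symm x)).comp (chartInvDeriv q x) := by
  rw [← mfderiv_eq_fderiv, coordFun, mfderiv_comp x (hf.mdifferentiableAt (by simp))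
    ((contMDiffAt_extChartAt_symm hx).mdifferentiableAt (by simp))]
  rfl

variable [FiniteDimensional ℝ E]

theorem innerAt_gradAt (g : SmoothMetric E Y) (f : Y → ℝ) (p : Y) :
    innerAt g p (gradAt g f p) = differentialAt f p :=
  (isInnerForm_innerAt g p).isInvertible.self_apply_inverse (differentialAt f p)

theorem contDiffOn_coordMetric (g : SmoothMetric E Y) (q : Y) :
    ContDiffOn ℝ ∞ (coordMetric g q) (extChartAt 𝓘(ℝ, E) q).target := by
  refine contDiffOn_clm_apply.2 fun u => contDiffOn_clm_apply.2 fun v x hx => ?_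
  have hsource := extChartAt_symm_mem_source hx
  have h := ContMDiffAt.comp x (contMDiffAt_inner_apply g
    (contMDiffAt_trivializationAt_symm hsource u)
    (contMDiffAt_trivializationAt_symm hsource v)) (contMDiffAt_extChartAt_symm hx)
  refine h.contDiffAt.contDiffWithinAt.congr_of_mem (fun y hy => ?_) hx
  rw [coordMetric_apply, chartInvDeriv_apply hy, chartInvDeriv_apply hy]
  rfl

theorem isCoordMetricOn_coordMetric (g : SmoothMetric E Y) (q : Y) :
    IsCoordMetricOn (coordMetric g q) (extChartAt 𝓘(ℝ, E) q).target where
  isOpen := isOpen_extChartAt_target q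
  contDiffOn := contDiffOn_coordMetric g q
  symm _ hx := (isInnerForm_coordMetric g hx).symm
  isInvertible _ hx := (isInnerForm_coordMetric g hx).isInvertible

theorem chartInvDeriv_coordGrad (g : SmoothMetric E Y) (hf : ContMDiff 𝓘(ℝ, E) 𝓘(ℝ, ℝ) ∞ f)
    (hx : x ∈ (extChartAt 𝓘(ℝ, E) q).target) :
    chartInvDeriv q x (coordGrad (coordMetric g q) (coordFun f q) x) =
      gradAt g f ((extChartAt 𝓘(ℝ, E) q).symm x) := by
  have hG := isCoordMetricOn_coordMetric g q
  obtain ⟨w, hw⟩ := (isInvertible_chartInvDeriv hx).surjective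
    (gradAt g f ((extChartAt 𝓘(ℝ, E) q).symm x))
  rw [← hw]
  refine congrArg _ (hG.ext_left hx fun z => ?_)
  rw [hG.apply_coordGrad hx, coordMetric_apply, hw, innerAt_gradAt, fderiv_coordFun hf hx]
  rfl

theorem coordGrad_self (g : SmoothMetric E Y) (hf : ContMDiff 𝓘(ℝ, E) 𝓘(ℝ, ℝ) ∞ f) (p : Y) :
    coordGrad (coordMetric g p) (coordFun f p) (extChartAt 𝓘(ℝ, E) p p) = gradAt g f p := by
  have h := chartInvDeriv_coordGrad g hf (mem_extChartAt_target (I := 𝓘(ℝ, E)) p)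
  rwa [chartInvDeriv_self, extChartAt_to_inv] at h

end MetricsInCharts

section UnitGradientOnManifold

variable {E : Type*} [NormedAddCommGroup E] [NormedSpace ℝ E] [FiniteDimensional ℝ E]
  {Y : Type*} [TopologicalSpace Y] [ChartedSpace E Y] [IsManifold 𝓘(ℝ, E) ∞ Y]
  {g : SmoothMetric E Y} {f : Y → ℝ} {l : ℝ}

/-- `f` is a smooth function whose gradient has norm one everywhere. -/
structure HasUnitGradient (g : SmoothMetric E Y) (f : Y → ℝ) : Prop where
  contMDiff : ContMDiff 𝓘(ℝ, E) 𝓘(ℝ, ℝ) ∞ f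
  innerAt_gradAt_self : ∀ p, innerAt g p (gradAt g f p) (gradAt g f p) = 1

namespace HasUnitGradient

theorem isUnitGradientOn_coordFun (hf : HasUnitGradient g f) (q : Y) :
    IsUnitGradientOn (coordMetric g q) (coordFun f q) (extChartAt 𝓘(ℝ, E) q).target where
  contDiffOn := contDiffOn_coordFun hf.contMDiff q
  apply_coordGrad x hx := by
    rw [fderiv_coordFun hf.contMDiff hx, ContinuousLinearMap.comp_apply,
      chartInvDeriv_coordGrad g hf.contMDiff hx, ← innerAt_gradAt g, hf.innerAt_gradAt_self]

theorem isInnerForm_stretchedForm (hf : HasUnitGradient g f) (hl : 1 ≤ l) (p : Y) :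
    IsInnerForm (stretchedFormAt g f l p) := by
  rw [stretchedFormAt, ← innerAt_gradAt g]
  exact (isInnerForm_innerAt g p).stretchedForm (hf.innerAt_gradAt_self p) hl

theorem innerAt_le_sq_mul_stretchedForm (hf : HasUnitGradient g f) (hl : 1 ≤ l) (p : Y) (u : E) :
    innerAt g p u u ≤ l ^ 2 * stretchedFormAt g f l p u u := by
  rw [stretchedFormAt, ← innerAt_gradAt g]
  exact (isInnerForm_innerAt g p).le_sq_mul_stretchedForm (hf.innerAt_gradAt_self p) hl u

theorem isVonNBounded_stretchedForm (hf : HasUnitGradient g f) (hl : 1 ≤ l) (p : Y) :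
    Bornology.IsVonNBounded ℝ
      {u : E | stretchedFormAt g f l p u u < 1} := by
  have hl₀ : 0 < l := one_pos.trans_le hl
  have hg : Bornology.IsVonNBounded ℝ {u : E | innerAt g p u u < 1} := g.isVonNBounded p
  refine (hg.image (l • ContinuousLinearMap.id ℝ E)).subset fun u hu => ?_
  refine ⟨l⁻¹ • u, ?_, by simp [smul_smul, hl₀.ne']⟩
  have hlt : innerAt g p u u < l ^ 2 :=
    (hf.innerAt_le_sq_mul_stretchedForm hl p u).trans_lt (mul_lt_of_lt_one_right (by positivity) hu)
  simp only [Set.mem_ofPred_eq, map_smul, smul_apply, smul_eq_mul]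
  rwa [← mul_assoc, ← mul_inv, ← sq, inv_mul_lt_iff₀ (by positivity), mul_one]

theorem contMDiff_stretchedForm (hf : HasUnitGradient g f) (l : ℝ) :
    ContMDiff 𝓘(ℝ, E) (𝓘(ℝ, E).prod 𝓘(ℝ, E →L[ℝ] E →L[ℝ] ℝ)) ∞
      (fun p => Bundle.TotalSpace.mk' (E →L[ℝ] E →L[ℝ] ℝ)
        (E := fun y : Y => TangentSpace 𝓘(ℝ, E) y →L[ℝ] TangentSpace 𝓘(ℝ, E) y →L[ℝ] ℝ)
        p (stretchedFormAt (E := E) g f l p)) := fun p => by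
  refine contMDiffAt_bilin_section _ fun u v => ?_
  have hu := contMDiffAt_trivializationAt_symm (mem_chart_source E p) u
  have hv := contMDiffAt_trivializationAt_symm (mem_chart_source E p) v
  exact (contMDiffAt_inner_apply g hu hv).sub (contMDiffAt_const.mul
    ((contMDiffAt_mfderiv_apply hf.contMDiff hu).mul (contMDiffAt_mfderiv_apply hf.contMDiff hv)))

/-- The metric `h^l = g - (1 - l⁻²) df ⊗ df`, for the unit gradient of `f` and `l ≥ 1`. -/
def stretchedMetric (hf : HasUnitGradient g f) (hl : 1 ≤ l) : SmoothMetric E Y where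
  inner p := stretchedFormAt (E := E) g f l p
  symm p := (hf.isInnerForm_stretchedForm hl p).symm
  pos p := (hf.isInnerForm_stretchedForm hl p).pos
  isVonNBounded := hf.isVonNBounded_stretchedForm hl
  contMDiff := hf.contMDiff_stretchedForm l

theorem isStretchedMetric_stretchedMetric (hf : HasUnitGradient g f) (hl : 1 ≤ l) :
    IsStretchedMetric g f l (hf.stretchedMetric hl) := fun p s t u v hu hv => by
  have hB := isInnerForm_innerAt g p
  have h := hB.stretchedForm_smul_add_smul_add (l := l) (hf.innerAt_gradAt_self p)
    ((hB.symm _ u).trans hu) ((hB.symm _ v).trans hv) s t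
  rwa [innerAt_gradAt] at h

theorem isCoordStretchOn_stretchedMetric (hf : HasUnitGradient g f) (hl : 1 ≤ l) (q : Y) :
    IsCoordStretchOn (coordMetric g q) (coordMetric (hf.stretchedMetric hl) q) (coordFun f q) l
      (extChartAt 𝓘(ℝ, E) q).target where
  isCoordMetricOn := isCoordMetricOn_coordMetric g q
  isCoordMetricOn_stretch := isCoordMetricOn_coordMetric _ q
  isUnitGradientOn := hf.isUnitGradientOn_coordFun q
  eq_stretchedForm x hx := by rw [fderiv_coordFun hf.contMDiff hx]; rfl
  ne_zero := by positivity

end HasUnitGradient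

end UnitGradientOnManifold

section PinchedLevels

variable {E : Type*} [NormedAddCommGroup E] [NormedSpace ℝ E]
  {Y : Type*} [TopologicalSpace Y] [ChartedSpace E Y] [IsManifold 𝓘(ℝ, E) ∞ Y]
  {g : SmoothMetric E Y} {f : Y → ℝ} {q : Y} {ε t : ℝ} {γ y : ℝ → E}

namespace IsCoordGeodesic

theorem velocity_eq (h : IsCoordGeodesic (coordMetric g q) (extChartAt 𝓘(ℝ, E) q).target ε γ y)
    (ht : t ∈ Set.Ioo (-ε) ε) :
    velocity (E := E) ((extChartAt 𝓘(ℝ, E) q).symm ∘ γ) t = chartInvDeriv q (γ t) (y t) := by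
  have hγ := (h.hasDerivAt t ht).hasFDerivAt.hasMFDerivAt
  have hψ := ((contMDiffAt_extChartAt_symm (h.mem t ht)).mdifferentiableAt (by simp)).hasMFDerivAt
  rw [velocity, (hψ.comp t hγ).mfderiv]
  exact congrArg (chartInvDeriv q (γ t)) (one_smul ℝ (y t))

variable [FiniteDimensional ℝ E]

theorem isGeodesicOn (h : IsCoordGeodesic (coordMetric g q) (extChartAt 𝓘(ℝ, E) q).target ε γ y) :
    IsGeodesicOn g ((extChartAt 𝓘(ℝ, E) q).symm ∘ γ) (-ε) ε := by
  have := FiniteDimensional.complete ℝ E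
  refine ⟨?_, fun t ht => ⟨q, extChartAt_symm_mem_source (h.mem t ht), ?_⟩⟩
  · exact ((contMDiffOn_extChartAt_symm (I := 𝓘(ℝ, E)) (n := ∞) q).of_le
      (WithTop.coe_le_coe.mpr le_top)).comp
        (h.contDiffOn (isCoordMetricOn_coordMetric g q)).contMDiffOn h.mem
  · have hγ : (fun s => extChartAt 𝓘(ℝ, E) q (((extChartAt 𝓘(ℝ, E) q).symm ∘ γ) s)) =ᶠ[𝓝 t] γ := by
      filter_upwards [isOpen_Ioo.mem_nhds ht] with s hs
      exact (extChartAt 𝓘(ℝ, E) q).right_inv (h.mem s hs)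
    simp only
    rw [hγ.deriv.deriv_eq, hγ.deriv_eq, h.deriv_deriv ht, (h.hasDerivAt t ht).deriv, hγ.eq_of_nhds]
    exact neg_add_cancel _

theorem isUnitSpeedGeodesicOn
    (h : IsCoordGeodesic (coordMetric g q) (extChartAt 𝓘(ℝ, E) q).target ε γ y)
    (hunit : coordMetric g q (γ 0) (y 0) (y 0) = 1) :
    IsUnitSpeedGeodesicOn g ((extChartAt 𝓘(ℝ, E) q).symm ∘ γ) (-ε) ε := by
  refine ⟨h.isGeodesicOn, fun t ht => ?_⟩
  rw [h.velocity_eq ht]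
  exact (h.speed_eq (isCoordMetricOn_coordMetric g q) ht).trans hunit

end IsCoordGeodesic

/-- The second derivative of `f` along a geodesic is the Hessian on its velocity, and every vector
is the initial velocity of a geodesic. -/
theorem exists_coordHessian_pinched [FiniteDimensional ℝ E]
    (hf : ContMDiff 𝓘(ℝ, E) 𝓘(ℝ, ℝ) ∞ f)
    (hlevels : HasPinchedConvexLevels g f) :
    ∃ c₁ c₂ : ℝ, 0 < c₁ ∧ ∀ (q : Y), ∀ x ∈ (extChartAt 𝓘(ℝ, E) q).target, ∀ u,
      fderiv ℝ (coordFun f q) x u = 0 →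
        c₁ * coordMetric g q x u u ≤ coordHessian (coordMetric g q) (coordFun f q) x u u ∧
          coordHessian (coordMetric g q) (coordFun f q) x u u ≤ c₂ * coordMetric g q x u u := by
  have := FiniteDimensional.complete ℝ E
  obtain ⟨c₁, c₂, hc₁, -, hlev⟩ := hlevels
  refine ⟨c₁, c₂, hc₁, fun q x hx u hu => ?_⟩
  have hG := isCoordMetricOn_coordMetric g q
  refine (isInnerForm_coordMetric g hx).pinched_of_pinched_on_unit
    (S := (fderiv ℝ (coordFun f q) x).ker) (fun v hv hunit => ?_) hu
  obtain ⟨ε, hε, γ, y, rfl, rfl, h⟩ := hG.exists_isCoordGeodesic hx v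
  have h₀ : (0 : ℝ) ∈ Set.Ioo (-ε) ε := ⟨neg_neg_iff_pos.2 hε, hε⟩
  rw [← h.deriv_deriv_comp hG.isOpen (contDiffOn_coordFun hf q) h₀]
  refine hlev ε ((extChartAt 𝓘(ℝ, E) q).symm ∘ γ) hε (h.isUnitSpeedGeodesicOn hunit) ?_
  have horth : innerAt g ((extChartAt 𝓘(ℝ, E) q).symm (γ 0))
      (gradAt g f ((extChartAt 𝓘(ℝ, E) q).symm (γ 0))) (chartInvDeriv q (γ 0) (y 0)) = 0 := by
    rw [innerAt_gradAt, ← ContinuousLinearMap.comp_apply, ← fderiv_coordFun hf hx]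
    exact hv
  rw [h.velocity_eq h₀]
  exact (g.symm _ _ _).trans horth

end PinchedLevels

section StretchedCurvature

variable {E : Type*} [NormedAddCommGroup E] [NormedSpace ℝ E]
  {Y : Type*} [TopologicalSpace Y] [ChartedSpace E Y] [IsManifold 𝓘(ℝ, E) ∞ Y]
  {g : SmoothMetric E Y} {f : Y → ℝ} {l Λ δ c₁ c₂ : ℝ}

theorem hasPinchedNegativeCurvature_of_bounds {K κ : ℝ} (hκ : 0 < κ)
    (h : ∀ (p : Y) (u v : E), LinearIndependent ℝ ![u, v] →
      -K ≤ sectionalCurvature g p u v ∧ sectionalCurvature g p u v ≤ -κ) :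
    HasPinchedNegativeCurvature g := by
  refine ⟨√κ, √(max K κ), Real.sqrt_pos.2 hκ, Real.sqrt_le_sqrt (le_max_right _ _),
    fun p u v huv => ?_⟩
  rw [Real.sq_sqrt hκ.le, Real.sq_sqrt (hκ.le.trans (le_max_right _ _))]
  exact ⟨(neg_le_neg (le_max_left _ _)).trans (h p u v huv).1, (h p u v huv).2⟩

theorem HasUnitGradient.sectionalCurvature_stretchedMetric_bounds [FiniteDimensional ℝ E]
    (hf : HasUnitGradient g f) {p : Y} (hc₁ : 0 < c₁)
    (hpinch : ∀ u, fderiv ℝ (coordFun f p) (extChartAt 𝓘(ℝ, E) p p) u = 0 →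
      c₁ * coordMetric g p (extChartAt 𝓘(ℝ, E) p p) u u ≤
          coordHessian (coordMetric g p) (coordFun f p) (extChartAt 𝓘(ℝ, E) p p) u u ∧
        coordHessian (coordMetric g p) (coordFun f p) (extChartAt 𝓘(ℝ, E) p p) u u ≤
          c₂ * coordMetric g p (extChartAt 𝓘(ℝ, E) p p) u u)
    (hΛ : 0 < Λ) (hδ : 0 < δ)
    (hK : ∀ u v : E, LinearIndependent ℝ ![u, v] → |sectionalCurvature g p u v| ≤ Λ)
    (hKgrad : ∀ v : E, LinearIndependent ℝ ![gradAt g f p, v] →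
      sectionalCurvature g p (gradAt (E := E) g f p) v ≤ -δ)
    (hl₁ : 1 ≤ l) (hl : Λ + 4 * Λ ^ 2 / δ + 1 ≤ (l ^ 2 - 1) * c₁ ^ 2)
    {u v : E} (huv : LinearIndependent ℝ ![u, v]) :
    -(Λ * l ^ 2 + (l ^ 2 - 1) * c₂ ^ 2) ≤ sectionalCurvature (hf.stretchedMetric hl₁) p u v ∧
      sectionalCurvature (hf.stretchedMetric hl₁) p u v ≤ -min (δ / 2) 1 := by
  have := FiniteDimensional.complete ℝ E
  have hx := mem_extChartAt_target (I := 𝓘(ℝ, E)) p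
  rw [← coordGrad_self g hf.contMDiff] at hKgrad
  simp only [sectionalCurvature_eq] at hK hKgrad ⊢
  exact (hf.isCoordStretchOn_stretchedMetric hl₁ p).coordSectionalCurvature_bounds hx
    (isInnerForm_coordMetric g hx) hc₁ hpinch hΛ hδ hK hKgrad hl₁ hl huv

end StretchedCurvature

section Distances

variable {E : Type*} [NormedAddCommGroup E] [NormedSpace ℝ E]
  {Y : Type*} [TopologicalSpace Y] [ChartedSpace E Y] [IsManifold 𝓘(ℝ, E) ∞ Y]
  {g h : SmoothMetric E Y} {C : ℝ≥0}

theorem riemDist_eq_iInf (g : SmoothMetric E Y) (p q : Y) :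
    riemDist g p q = ⨅ (γ : Path p q)
        (_ : ContMDiff (modelWithCornersEuclideanHalfSpace 1) 𝓘(ℝ, E) 1 γ),
      ∫⁻ t, ENNReal.ofReal √(g.inner (γ t)
        (mfderiv (modelWithCornersEuclideanHalfSpace 1) 𝓘(ℝ, E) γ t 1)
        (mfderiv (modelWithCornersEuclideanHalfSpace 1) 𝓘(ℝ, E) γ t 1)) := by
  let _ : Bundle.RiemannianBundle (fun p : Y => TangentSpace 𝓘(ℝ, E) p) := ⟨g.toRiemannianMetric⟩
  have hnorm (p : Y) (v : TangentSpace 𝓘(ℝ, E) p) :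
      ‖v‖ₑ = ENNReal.ofReal √(g.inner p v v) := by
    rw [← ofReal_norm]
    rfl
  rw [riemDist, Manifold.riemannianEDist]
  simp only [hnorm]

theorem riemDist_le_mul (hC : C ≠ 0)
    (hgh : ∀ (p : Y) (u : E), innerAt g p u u ≤ C ^ 2 * innerAt h p u u) (p q : Y) :
    riemDist g p q ≤ C * riemDist h p q := by
  rw [riemDist_eq_iInf, riemDist_eq_iInf]
  simp only [ENNReal.mul_iInf_of_ne (ENNReal.coe_ne_zero.2 hC) ENNReal.coe_ne_top]
  refine iInf₂_mono fun γ _ => ?_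
  rw [← MeasureTheory.lintegral_const_mul' _ _ ENNReal.coe_ne_top]
  refine MeasureTheory.lintegral_mono fun t => ?_
  rw [← ENNReal.ofReal_coe_nnreal, ← ENNReal.ofReal_mul C.coe_nonneg]
  refine ENNReal.ofReal_le_ofReal ?_
  rw [← Real.sqrt_sq C.coe_nonneg, ← Real.sqrt_mul (sq_nonneg _)]
  exact Real.sqrt_le_sqrt (hgh _ _)

theorem lipschitzEquivalent_of_le (hC : C ≠ 0)
    (hgh : ∀ (p : Y) (u : E), innerAt g p u u ≤ C ^ 2 * innerAt h p u u)
    (hhg : ∀ (p : Y) (u : E), innerAt h p u u ≤ C ^ 2 * innerAt g p u u) :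
    LipschitzEquivalent g h :=
  ⟨C, fun p q => ⟨riemDist_le_mul hC hgh p q, riemDist_le_mul hC hhg p q⟩⟩

theorem HasUnitGradient.lipschitzEquivalent_stretchedMetric [FiniteDimensional ℝ E]
    {f : Y → ℝ} {l : ℝ} (hf : HasUnitGradient g f) (hl : 1 ≤ l) :
    LipschitzEquivalent g (hf.stretchedMetric hl) := by
  have hl₀ : 0 < l := one_pos.trans_le hl
  refine lipschitzEquivalent_of_le (C := l.toNNReal) (Real.toNNReal_pos.2 hl₀).ne' ?_ ?_ <;>
    rw [Real.coe_toNNReal l hl₀.le]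
  · exact hf.innerAt_le_sq_mul_stretchedForm hl
  · exact fun p u => (stretchedForm_le hl u).trans (le_mul_of_one_le_left
      ((isInnerForm_innerAt g p).apply_self_nonneg u) (one_le_pow₀ hl))

end Distances

theorem lemma1_general {E : Type*} [NormedAddCommGroup E] [NormedSpace ℝ E]
    [FiniteDimensional ℝ E] {Y : Type*} [TopologicalSpace Y] [ChartedSpace E Y]
    [IsManifold 𝓘(ℝ, E) ∞ Y] (g : SmoothMetric E Y) (Λ δ : ℝ) (hδ : 0 < δ)
    (hK : ∀ (p : Y) (u v : TangentSpace 𝓘(ℝ, E) p), LinearIndependent ℝ ![u, v] →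
      |sectionalCurvature g p u v| ≤ Λ)
    (f : Y → ℝ) (hf : ContMDiff 𝓘(ℝ, E) 𝓘(ℝ, ℝ) ∞ f)
    (hgrad : ∀ p : Y, g.inner p (riemGrad g f p) (riemGrad g f p) = 1)
    (hlevels : HasPinchedConvexLevels g f)
    (hKgrad : ∀ (p : Y) (u v : TangentSpace 𝓘(ℝ, E) p), LinearIndependent ℝ ![u, v] →
      riemGrad g f p ∈ Submodule.span ℝ {u, v} → sectionalCurvature g p u v < -δ) :
    ∃ l₀ : ℝ, 0 < l₀ ∧ ∀ l : ℝ, l₀ ≤ l → ∃ h : SmoothMetric E Y,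
      IsStretchedMetric g f l h ∧ HasPinchedNegativeCurvature h ∧ LipschitzEquivalent g h := by
  have hu : HasUnitGradient g f := ⟨hf, hgrad⟩
  obtain ⟨c₁, c₂, hc₁, hpinch⟩ := exists_coordHessian_pinched hf hlevels
  set M := max Λ 1
  have hM : 0 < M := lt_max_of_lt_right one_pos
  set A := (M + 4 * M ^ 2 / δ + 1) / c₁ ^ 2 with hA
  have hA₀ : 0 < A := by positivity
  refine ⟨1 + A, by positivity, fun l hl => ?_⟩
  have hl₁ : 1 ≤ l := by linarith
  have hlA : M + 4 * M ^ 2 / δ + 1 ≤ (l ^ 2 - 1) * c₁ ^ 2 := by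
    rw [← div_le_iff₀ (by positivity), ← hA]
    nlinarith
  refine ⟨hu.stretchedMetric hl₁, hu.isStretchedMetric_stretchedMetric hl₁, ?_,
    hu.lipschitzEquivalent_stretchedMetric hl₁⟩
  refine hasPinchedNegativeCurvature_of_bounds (lt_min (half_pos hδ) one_pos) fun p _ _ huv =>
    hu.sectionalCurvature_stretchedMetric_bounds hc₁ (hpinch p _ (mem_extChartAt_target p)) hM hδ
      (fun u v huv => (hK p u v huv).trans (le_max_left _ _))
      (fun v hv => (hKgrad p _ v hv (Submodule.subset_span (by simp [gradAt]))).le) hl₁ hlA huv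

end

theorem lemma1 {E : Type*} [NormedAddCommGroup E] [NormedSpace ℝ E] [FiniteDimensional ℝ E]
    {Y : Type*} [TopologicalSpace Y] [T2Space Y] [SecondCountableTopology Y]
    [ChartedSpace E Y] [IsManifold 𝓘(ℝ, E) ∞ Y]
    (g : SmoothMetric E Y) (hcomplete : IsCompleteMetric g)
    (Λ δ : ℝ) (hδ : 0 < δ)
    (hK : ∀ (p : Y) (u v : TangentSpace 𝓘(ℝ, E) p), LinearIndependent ℝ ![u, v] →
      |sectionalCurvature g p u v| ≤ Λ)
    (f : Y → ℝ) (hf : ContMDiff 𝓘(ℝ, E) 𝓘(ℝ, ℝ) ∞ f)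
    (hgrad : ∀ p : Y, g.inner p (riemGrad g f p) (riemGrad g f p) = 1)
    (hlevels : HasPinchedConvexLevels g f)
    (hKgrad : ∀ (p : Y) (u v : TangentSpace 𝓘(ℝ, E) p), LinearIndependent ℝ ![u, v] →
      riemGrad g f p ∈ Submodule.span ℝ {u, v} → sectionalCurvature g p u v < -δ) :
    ∃ l₀ : ℝ, 0 < l₀ ∧ ∀ l : ℝ, l₀ ≤ l → ∃ h : SmoothMetric E Y,
      IsStretchedMetric g f l h ∧ HasPinchedNegativeCurvature h ∧ LipschitzEquivalent g h :=
  lemma1_general g Λ δ hδ hK f hf hgrad hlevels hKgrad
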